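/- Let $\Sigma$ be a connected oriented surface of genus $g$ with a nonempty finite set $\mathcal P$ of punctures and $\chi(\Sigma)<0$, and let $\lambda$ be an ideal triangulation of $\Sigma$ (self-folded faces are allowed), with set of faces $F(\lambda)$. For a lattice $L$ with an integer-valued skew-symmetric form $\omega$ and $q\in\mathbb C^\times$ (in particular for $q$ a root of unity of odd order), let $\mathbb T_q(L)$ be the $\mathbb C$-algebra with basis $x^k$, $k\in L$, and product $x^kx^l=q^{\omega(k,l)}x^{k+l}$. Define the following. * The Kashaev lattice is $L_\lambda=\bigoplus_{t\in F(\lambda)}\mathbb Z^3/\mathbb Z\mathbf 1$. In each summand the basis vectors correspond to the sides of $t$ in counterclockwise order. The form $\omega$ is the direct sum of the forms induced by the matrix $\begin{pmatrix}0&1&-1\\-1&0&1\\1&-1&0\end{pmatrix}$. Put $\mathbb T^{\mathrm K}_q(\lambda)=\mathbb T_q(L_\lambda)$. * On $\mathbb Z^\lambda$ let $\varepsilon_{ab}$ be the number of corners of faces at which $b$ follows $a$ counterclockwise around the face, minus the number of corners at which $a$ follows $b$. Put $R_\lambda=\mathbb Z^\lambda/\mathbb Z\mathbf 1$ with the induced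 form, $\mathbb T^{\mathrm{CF}}_q(\lambda)=\mathbb T_q(\mathbb Z^\lambda)$ with monomials $X^k$, and $\mathbb T^{\mathrm{CFr}}_q(\lambda)=\mathbb T^{\mathrm{CF}}_q(\lambda)/\langle X^{\mathbf 1}-1\rangle$; for $r\in R_\lambda$, $X^r$ denotes the class of $X^k$ for any representative $k$ of $r$. * $H=H_1(\Sigma,\mathbb Z)$ carries twice the intersection form, and $\mathbb T_q(H)$ is its quantum torus. * For $v\in\mathcal P$, $c_v\in R_\lambda$ is the class of the vector that counts how many times each edge ends on $v$, and $\gamma_v\in H$ is the class of a small counterclockwise circle around $v$. With $P_\lambda=\mathbb Z^{\mathcal P}/\mathbb Z\mathbf 1$, the maps $v\mapsto X^{c_v}$ and $v\mapsto x^{\gamma_v}$ make $\mathbb T^{\mathrm{CFr}}_q(\lambda)$ and $\mathbb T_q(H)$ algebras over the commutative group algebra $\mathbb C[P_\lambda]$. * $i_{\mathrm{CFr}}:R_\lambda\to L_\lambda$ sends each edge to the sum of the two corresponding sides in the adjacent faces. $i_H:H\to L_\lambda$ sends a class, represented by curves that cross each face in segments around its corners, to the signed sum over these segments of the generators of the sides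 opposite to the corners, with sign $+$ for clockwise and $-$ for counterclockwise segments. Then the homomorphisms $i_{\mathrm{CFr}}$ and $i_H$ are injective, and they combine to an injective homomorphism $$i:\ (R_\lambda\oplus H)/\langle c_v=\gamma_v\rangle\hookrightarrow L_\lambda,\qquad i([r,h])=i_{\mathrm{CFr}}(r)+i_H(h),$$ which respects the forms: $\omega(i[r,h],i[r',h'])=\varepsilon(r,r')+2\,(h\cdot h')$ for all $r,r'\in R_\lambda$ and $h,h'\in H$. Moreover, for every $q\in\mathbb C^\times$ there is an associated injective homomorphism of $\mathbb C$-algebras $$i_q:\ \mathbb T^{\mathrm{CFr}}_q(\lambda)\otimes_{\mathbb C[P_\lambda]}\mathbb T_q(H)\hookrightarrow\mathbb T^{\mathrm K}_q(\lambda),\qquad i_q(X^r\otimes x^h)=x^{i([r,h])}.$$ -/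

import Mathlib

open scoped TensorProduct

set_option linter.unusedSectionVars false
set_option linter.unusedSimpArgs false

noncomputable section

/-! ### Forms on quotient lattices and quantum tori -/

/-- The bilinear form induced on `M ⧸ N` by a form whose two radicals contain `N`. -/
def descendForm {M : Type*} [AddCommGroup M] (N : Submodule ℤ M) (B : LinearMap.BilinForm ℤ M)
    (hl : ∀ n ∈ N, ∀ m, B n m = 0) (hr : ∀ n ∈ N, ∀ m, B m n = 0) :
    LinearMap.BilinForm ℤ (M ⧸ N) :=
  N.liftQ
    { toFun := fun m => N.liftQ (B m) (fun n hn => hr n hn m)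
      map_add' := fun a b => by
        apply LinearMap.ext
        intro x
        obtain ⟨x, rfl⟩ := N.mkQ_surjective x
        change B (a + b) x = B a x + B b x
        simp
      map_smul' := fun a b => by
        apply LinearMap.ext
        intro x
        obtain ⟨x, rfl⟩ := N.mkQ_surjective x
        change B (a • b) x = a • B b x
        simp }
    (fun n hn => by
      rw [LinearMap.mem_ker]
      apply LinearMap.ext
      intro x
      obtain ⟨x, rfl⟩ := N.mkQ_surjective x
      exact hl n hn x)

theorem descendForm_mk {M : Type*} [AddCommGroup M] (N : Submodule ℤ M)
    (B : LinearMap.BilinForm ℤ M)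
    (hl : ∀ n ∈ N, ∀ m, B n m = 0) (hr : ∀ n ∈ N, ∀ m, B m n = 0) (a b : M) :
    descendForm N B hl hr (Submodule.Quotient.mk a) (Submodule.Quotient.mk b) = B a b := rfl

/-- The quantum torus `𝕋_q(L)` of a lattice `L` with form `ω`: the complex vector space with
basis `x^k`, `k ∈ L`, and product `x^k x^l = q^{ω(k,l)} x^{k+l}`. -/
def QTorus {L : Type*} [AddCommGroup L] (_q : ℂˣ) (_ω : LinearMap.BilinForm ℤ L) : Type _ :=
  L →₀ ℂ

namespace QTorus

variable {L : Type*} [AddCommGroup L] (q : ℂˣ) (ω : LinearMap.BilinForm ℤ L)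

instance : AddCommGroup (QTorus q ω) := inferInstanceAs (AddCommGroup (L →₀ ℂ))
instance : Module ℂ (QTorus q ω) := inferInstanceAs (Module ℂ (L →₀ ℂ))

/-- The basis element `x^k`. -/
def X (k : L) : QTorus q ω := (Finsupp.single k 1 : L →₀ ℂ)

theorem induction {p : QTorus q ω → Prop} (f : QTorus q ω) (h0 : p 0)
    (hadd : ∀ f g, p f → p g → p (f + g)) (hX : ∀ (a : ℂ) k, p (a • X q ω k)) : p f :=
  Finsupp.induction_linear (f : L →₀ ℂ) h0 hadd (fun k a => by
    have h := hX a k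
    have e : a • X q ω k = (Finsupp.single k a : L →₀ ℂ) := by
      change a • (Finsupp.single k 1 : L →₀ ℂ) = _
      simp
    rwa [e] at h)

/-- The product, as a bilinear map. -/
def mulLin : QTorus q ω →ₗ[ℂ] QTorus q ω →ₗ[ℂ] QTorus q ω :=
  Finsupp.lsum ℂ (M := ℂ) (N := QTorus q ω →ₗ[ℂ] QTorus q ω) fun k =>
    LinearMap.toSpanSingleton ℂ (QTorus q ω →ₗ[ℂ] QTorus q ω)
      (Finsupp.lsum ℂ (M := ℂ) (N := QTorus q ω) fun l =>
        LinearMap.toSpanSingleton ℂ (QTorus q ω) (((q ^ ω k l : ℂˣ) : ℂ) • X q ω (k + l)))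

theorem mulLin_X (k l : L) :
    mulLin q ω (X q ω k) (X q ω l) = ((q ^ ω k l : ℂˣ) : ℂ) • X q ω (k + l) := by
  have h1 : mulLin q ω (X q ω k) = (Finsupp.lsum ℂ (M := ℂ) (N := QTorus q ω) fun l =>
        LinearMap.toSpanSingleton ℂ (QTorus q ω)
          (((q ^ ω k l : ℂˣ) : ℂ) • X q ω (k + l))) := by
    unfold mulLin
    refine (Finsupp.lsum_single ℂ _ k (1 : ℂ)).trans ?_
    exact LinearMap.toSpanSingleton_apply_one ..
  rw [h1]
  refine (Finsupp.lsum_single ℂ _ l (1 : ℂ)).trans ?_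
  exact LinearMap.toSpanSingleton_apply_one ..

instance : Mul (QTorus q ω) := ⟨fun f g => mulLin q ω f g⟩
instance : One (QTorus q ω) := ⟨X q ω 0⟩

theorem mul_def (f g : QTorus q ω) : f * g = mulLin q ω f g := rfl
theorem one_def : (1 : QTorus q ω) = X q ω 0 := rfl

theorem X_mul_X (k l : L) :
    X q ω k * X q ω l = ((q ^ ω k l : ℂˣ) : ℂ) • X q ω (k + l) := mulLin_X q ω k l

theorem one_mul' (f : QTorus q ω) : 1 * f = f := by
  induction f using QTorus.induction with
  | h0 => simp [mul_def]
  | hadd f g hf hg => rw [mul_def] at *; rw [map_add, hf, hg]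
  | hX a k => rw [mul_def, map_smul, one_def, mulLin_X]; simp

theorem mul_one' (f : QTorus q ω) : f * 1 = f := by
  induction f using QTorus.induction with
  | h0 => simp [mul_def]
  | hadd f g hf hg => rw [mul_def] at *; rw [map_add, LinearMap.add_apply, hf, hg]
  | hX a k => rw [mul_def, map_smul, LinearMap.smul_apply, one_def, mulLin_X]; simp

theorem mul_assoc' (f g h : QTorus q ω) : f * g * h = f * (g * h) := by
  simp only [mul_def]
  induction f using QTorus.induction with
  | h0 => simp
  | hadd f f' hf hf' => simp only [map_add, LinearMap.add_apply, hf, hf']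
  | hX a k =>
    induction g using QTorus.induction with
    | h0 => simp
    | hadd g g' hg hg' => simp only [map_add, LinearMap.add_apply, hg, hg']
    | hX b l =>
      induction h using QTorus.induction with
      | h0 => simp
      | hadd h h' hh hh' => simp only [map_add, hh, hh']
      | hX c m =>
        simp only [map_smul, LinearMap.smul_apply, mulLin_X, smul_smul, map_add,
          LinearMap.add_apply, zpow_add, Units.val_mul, add_assoc]
        congr 1
        ring

instance : Ring (QTorus q ω) :=
  { (inferInstance : AddCommGroup (QTorus q ω)), (inferInstance : Mul (QTorus q ω)),
    (inferInstance : One (QTorus q ω)) with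
    left_distrib := fun f g h => by simp only [mul_def, map_add]
    right_distrib := fun f g h => by simp only [mul_def, map_add, LinearMap.add_apply]
    zero_mul := fun f => by simp only [mul_def, map_zero, LinearMap.zero_apply]
    mul_zero := fun f => by simp only [mul_def, map_zero]
    mul_assoc := mul_assoc' q ω
    one_mul := one_mul' q ω
    mul_one := mul_one' q ω }

instance : Algebra ℂ (QTorus q ω) :=
  Algebra.ofModule
    (fun r x y => by simp only [mul_def, map_smul, LinearMap.smul_apply])
    (fun r x y => by simp only [mul_def, map_smul])

theorem X_zero : X q ω 0 = 1 := rfl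

/-- Monomials whose exponents lie in the radical are multiplicative and central. -/
theorem X_mul_X_of_radical (k l : L) (h : ω k l = 0) : X q ω k * X q ω l = X q ω (k + l) := by
  rw [X_mul_X, h]; simp

theorem X_central (k : L) (hl : ∀ m, ω k m = 0) (hr : ∀ m, ω m k = 0) (f : QTorus q ω) :
    Commute (X q ω k) f := by
  induction f using QTorus.induction with
  | h0 => exact Commute.zero_right _
  | hadd f g hf hg => exact hf.add_right hg
  | hX a l =>
    refine Commute.smul_right ?_ a
    rw [Commute, SemiconjBy, X_mul_X_of_radical _ _ _ _ (hl l), X_mul_X_of_radical _ _ _ _ (hr l),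
      add_comm]

end QTorus

/-! ### The lattice of a triangle -/

/-- The lattice `L_t = ℤ³/ℤ𝟏`; the class of the `i`-th basis vector is the generator of the
`i`-th side of `t`. -/
abbrev FaceLattice : Type := (Fin 3 → ℤ) ⧸ Submodule.span ℤ {(1 : Fin 3 → ℤ)}

/-- The skew-symmetric form on `ℤ³` under which each basis vector pairs to `1` with the next one. -/
def faceForm₀ : LinearMap.BilinForm ℤ (Fin 3 → ℤ) :=
  Matrix.toBilin' !![0, 1, -1; -1, 0, 1; 1, -1, 0]

theorem faceForm₀_apply (x y : Fin 3 → ℤ) : faceForm₀ x y =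
    x 0 * y 1 - x 0 * y 2 - x 1 * y 0 + x 1 * y 2 + x 2 * y 0 - x 2 * y 1 := by
  simp [faceForm₀, Matrix.toBilin'_apply, Fin.sum_univ_three]
  ring

/-- The induced skew-symmetric form on `L_t`. -/
def faceForm : LinearMap.BilinForm ℤ FaceLattice :=
  descendForm _ faceForm₀
    (fun n hn m => by
      obtain ⟨a, rfl⟩ := Submodule.mem_span_singleton.1 hn
      simp [faceForm₀_apply]; ring)
    (fun n hn m => by
      obtain ⟨a, rfl⟩ := Submodule.mem_span_singleton.1 hn
      simp [faceForm₀_apply])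

/-! ### Ideally triangulated punctured surfaces -/

/-- An ideal triangulation `λ` of a connected oriented punctured surface `Σ`, with finite set `F`
of faces.  The sides of each face `t` are numbered `(t, 0)`, `(t, 1)`, `(t, 2)` in the
counterclockwise order, and `Σ` is obtained from the disjoint union of the faces (triangles
without their vertices) by gluing every side `s` to the side `glue s ≠ s` by an
orientation-reversing identification.  Faces may be glued to themselves, so self-folded faces
are allowed. -/
structure IdealTriangulation (F : Type*) where
  glue : Equiv.Perm (F × Fin 3)
  glue_glue : ∀ s, glue (glue s) = s
  glue_ne : ∀ s, glue s ≠ s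
  nonempty : Nonempty F
  connected : ∀ t t' : F,
    Relation.ReflTransGen (fun a b : F => ∃ i j : Fin 3, glue (a, i) = (b, j)) t t'

namespace IdealTriangulation

variable {F : Type*} (T : IdealTriangulation F)

/-- The set `λ` of edges: each edge is a side together with the side it is glued to. -/
def Edge : Type _ := Quotient (Equiv.Perm.SameCycle.setoid T.glue)

/-- The edge containing a side. -/
def edge (s : F × Fin 3) : T.Edge := Quotient.mk _ s

/-- We write `(t, i)` also for the corner of the face `t` opposite to the side `(t, i)`.
The ideal vertex of this corner is the end of the side `(t, i + 1)` and the start of the side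
`(t, i + 2)`, where sides are directed counterclockwise around `t`.  The permutation `turn` sends
a corner to the next corner counterclockwise around the same puncture, reached by crossing the
side `(t, i + 1)`. -/
def turn : Equiv.Perm (F × Fin 3) where
  toFun κ := ((T.glue (κ.1, κ.2 + 1)).1, (T.glue (κ.1, κ.2 + 1)).2 + 1)
  invFun κ := ((T.glue (κ.1, κ.2 - 1)).1, (T.glue (κ.1, κ.2 - 1)).2 - 1)
  left_inv κ := by simp [T.glue_glue]
  right_inv κ := by simp [T.glue_glue]

/-- The set `𝒫` of punctures: cycles of corners. -/
def Puncture : Type _ := Quotient (Equiv.Perm.SameCycle.setoid T.turn)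

/-- The puncture at a corner. -/
def puncture (κ : F × Fin 3) : T.Puncture := Quotient.mk _ κ

/-- The puncture at which the side `s` starts (in the counterclockwise direction of its face). -/
def start (s : F × Fin 3) : T.Puncture := T.puncture (s.1, s.2 + 1)

/-- The puncture at which the side `s` ends. -/
def finish (s : F × Fin 3) : T.Puncture := T.puncture (s.1, s.2 + 2)

instance : DecidableEq T.Edge := Classical.decEq _
instance : DecidableEq T.Puncture := Classical.decEq _
instance [Finite F] : Finite T.Edge := Quotient.finite _
instance [Finite F] : Finite T.Puncture := Quotient.finite _
instance [Fintype F] : Fintype T.Edge := Fintype.ofFinite _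
instance [Fintype F] : Fintype T.Puncture := Fintype.ofFinite _

theorem edge_glue (s : F × Fin 3) : T.edge (T.glue s) = T.edge s :=
  Quotient.sound (show T.glue.SameCycle (T.glue s) s from ⟨-1, by simp⟩)

theorem edge_eq_iff (s s' : F × Fin 3) : T.edge s = T.edge s' ↔ s = s' ∨ s = T.glue s' := by
  constructor
  · intro h
    obtain ⟨n, hn⟩ : T.glue.SameCycle s s' := Quotient.exact h
    have h2 : T.glue ^ (2 : ℤ) = 1 := by
      ext1 x
      exact T.glue_glue x
    rcases Int.even_or_odd' n with ⟨m, rfl | rfl⟩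
    · left
      rw [zpow_mul, h2, one_zpow] at hn
      exact hn
    · right
      rw [zpow_add, zpow_mul, h2, one_zpow, one_mul, zpow_one] at hn
      rw [← hn, T.glue_glue]
  · rintro (rfl | rfl)
    · rfl
    · exact T.edge_glue s'

theorem puncture_turn (κ : F × Fin 3) : T.puncture (T.turn κ) = T.puncture κ :=
  Quotient.sound (show T.turn.SameCycle (T.turn κ) κ from ⟨-1, by simp⟩)

theorem turn_finish (s : F × Fin 3) :
    T.turn (s.1, s.2 + 2) = ((T.glue s).1, (T.glue s).2 + 1) := by
  have h : s.2 + 2 + 1 = s.2 := by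
    generalize s.2 = j; revert j; decide
  change ((T.glue (s.1, s.2 + 2 + 1)).1, (T.glue (s.1, s.2 + 2 + 1)).2 + 1) = _
  rw [h]

theorem start_glue (s : F × Fin 3) : T.start (T.glue s) = T.finish s := by
  unfold start finish
  rw [← T.turn_finish, T.puncture_turn]

theorem finish_glue (s : F × Fin 3) : T.finish (T.glue s) = T.start s := by
  rw [← T.start_glue, T.glue_glue]

variable [Fintype F] [DecidableEq F]

/-! #### The Kashaev lattice -/

/-- The Kashaev lattice `L_λ = ⨁_t L_t`. -/
abbrev L (_T : IdealTriangulation F) : Type _ := F → FaceLattice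

/-- The direct sum form `ω` on `L_λ`. -/
def kashaevForm : LinearMap.BilinForm ℤ T.L :=
  ∑ t : F, faceForm.compl₁₂ (LinearMap.proj t) (LinearMap.proj t)

/-- The Kashaev algebra `𝕋^K_q(λ)`. -/
abbrev TK (q : ℂˣ) : Type _ := QTorus q T.kashaevForm

/-- The generator of `L_λ` assigned to a side. -/
def sideGen (s : F × Fin 3) : T.L :=
  Pi.single s.1 (Submodule.Quotient.mk (Pi.single s.2 1))

/-! #### The Chekhov--Fock lattice -/

/-- `ε_{ab}`: the number of corners at which the edge `b` follows the edge `a` in the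
counterclockwise order of the sides of a face, minus the number of corners at which `a`
follows `b`. -/
def eps (a b : T.Edge) : ℤ :=
  (Finset.univ.filter fun s : F × Fin 3 => T.edge s = a ∧ T.edge (s.1, s.2 + 1) = b).card -
  (Finset.univ.filter fun s : F × Fin 3 => T.edge s = b ∧ T.edge (s.1, s.2 + 1) = a).card

/-- The bilinear form `ε` on `ℤ^λ`. -/
def epsForm : LinearMap.BilinForm ℤ (T.Edge → ℤ) := Matrix.toBilin' (Matrix.of T.eps)

/-- `c_v ∈ ℤ^λ` counts how many times each edge ends on `v`.  The two ends of an edge are the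
starts of its two sides. -/
def c (v : T.Puncture) : T.Edge → ℤ := fun e =>
  (Finset.univ.filter fun s : F × Fin 3 => T.edge s = e ∧ T.start s = v).card

/-- The restricted lattice `R_λ = ℤ^λ/ℤ𝟏`. -/
abbrev R : Type _ := (T.Edge → ℤ) ⧸ Submodule.span ℤ {(1 : T.Edge → ℤ)}

/-- `P_λ = ℤ^𝒫/ℤ𝟏`. -/
abbrev P : Type _ := (T.Puncture → ℤ) ⧸ Submodule.span ℤ {(1 : T.Puncture → ℤ)}

/-! #### Homology

Choose the midpoint of every edge and, in every face, the triangle spanned by the midpoints of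
its three sides.  Every corner of a face, cut off by a side of that medial triangle, retracts
away from the puncture onto that side, so `Σ` deformation retracts onto the union of the medial
triangles.  It is a two-dimensional cell complex with one vertex for every edge of `λ`, one
1-cell for every corner (a segment around the corner) and one 2-cell for every face.
`H₁(Σ; ℤ)` is its cellular homology. -/

/-- Cellular 1-chains: the basis vector of the corner `(t, i)` is the segment that goes
counterclockwise around that corner, from the midpoint of the side `(t, i + 2)` to the midpoint of
the side `(t, i + 1)`. -/
abbrev Chain₁ (_T : IdealTriangulation F) : Type _ := F × Fin 3 → ℤ

/-- The boundary map from 1-chains to 0-chains. -/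
def bd₁ : T.Chain₁ →ₗ[ℤ] (T.Edge → ℤ) :=
  Fintype.linearCombination ℤ fun κ : F × Fin 3 =>
    (Pi.single (T.edge (κ.1, κ.2 + 1)) 1 - Pi.single (T.edge (κ.1, κ.2 + 2)) 1 : T.Edge → ℤ)

/-- The boundary map from 2-chains to 1-chains.  (The three segments of a face run, as a loop,
clockwise around its medial triangle.) -/
def bd₂ : (F → ℤ) →ₗ[ℤ] T.Chain₁ :=
  Fintype.linearCombination ℤ fun t : F => (∑ i : Fin 3, Pi.single (t, i) 1 : T.Chain₁)

/-- The group of 1-cycles. -/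
abbrev Cycles : Submodule ℤ T.Chain₁ := LinearMap.ker T.bd₁

/-- The 1-boundaries, inside the group of 1-cycles. -/
def Boundaries : Submodule ℤ T.Cycles := (LinearMap.range T.bd₂).comap T.Cycles.subtype

/-- `H = H₁(Σ; ℤ)`. -/
abbrev H : Type _ := T.Cycles ⧸ T.Boundaries

/-- The net number of times that a 1-chain enters the face of `s` through the side `s`. -/
def inflow (s : F × Fin 3) : T.Chain₁ →ₗ[ℤ] ℤ :=
  LinearMap.proj (R := ℤ) (φ := fun _ : F × Fin 3 => ℤ) (s.1, s.2 + 1) -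
    LinearMap.proj (R := ℤ) (φ := fun _ : F × Fin 3 => ℤ) (s.1, s.2 + 2)

/-- Sliding every segment around a corner into the puncture replaces it by two halves of edges.
In this way a 1-cycle is homologous, in the surface with the punctures filled in and relative to
the punctures, to a linear combination of edges.  `edgeCoeff s` is the coefficient in it of the
edge of `s`, directed as the side `s`: the net number of segments that arrive
(through the other face of that edge) minus those that depart (in the face of `s`), along the half
of the edge between the start of `s` and the midpoint. -/
def edgeCoeff (s : F × Fin 3) : T.Chain₁ →ₗ[ℤ] ℤ :=
  LinearMap.proj (R := ℤ) (φ := fun _ : F × Fin 3 => ℤ) ((T.glue s).1, (T.glue s).2 + 2) -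
    LinearMap.proj (R := ℤ) (φ := fun _ : F × Fin 3 => ℤ) (s.1, s.2 + 1)

/-- The intersection number of two cycles: the first is written as a combination of edges `e` as
in `edgeCoeff`, and at each edge one counts how many times the second crosses `e` (from right
to left of `e`, so that the sign is that of the standard orientation).  One side is chosen to
direct each edge; the term of the edge does not depend on it. -/
def interCycles : LinearMap.BilinForm ℤ T.Cycles :=
  ∑ e : T.Edge, (LinearMap.mul ℤ ℤ).compl₁₂
    (T.edgeCoeff e.out ∘ₗ T.Cycles.subtype) (T.inflow e.out ∘ₗ T.Cycles.subtype)

theorem inflow_apply (s : F × Fin 3) (b : T.Chain₁) :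
    T.inflow s b = b (s.1, s.2 + 1) - b (s.1, s.2 + 2) := rfl

theorem edgeCoeff_apply (s : F × Fin 3) (b : T.Chain₁) :
    T.edgeCoeff s b = b ((T.glue s).1, (T.glue s).2 + 2) - b (s.1, s.2 + 1) := rfl

theorem sum_shift {M : Type*} [AddCommMonoid M] (f : F × Fin 3 → M) (k : Fin 3) :
    ∑ s : F × Fin 3, f (s.1, s.2 + k) = ∑ s, f s :=
  Fintype.sum_equiv ((Equiv.refl F).prodCongr (Equiv.addRight k)) _ _ (fun _ => rfl)

theorem fiber_edge (s : F × Fin 3) :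
    (Finset.univ.filter fun s' : F × Fin 3 => T.edge s' = T.edge s) = {s, T.glue s} := by
  ext s'
  simp [T.edge_eq_iff]

theorem sum_fiber (s : F × Fin 3) (g : F × Fin 3 → ℤ) :
    ∑ s' : F × Fin 3 with T.edge s' = T.edge s, g s' = g s + g (T.glue s) := by
  rw [T.fiber_edge, Finset.sum_pair (T.glue_ne s).symm]

theorem edge_out (e : T.Edge) : T.edge (Quotient.out e) = e := Quotient.out_eq e

theorem sum_edges (g : F × Fin 3 → ℤ) (hg : ∀ s, g (T.glue s) = g s) :
    ∑ s, g s = 2 * ∑ e : T.Edge, g (Quotient.out e) := by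
  rw [← Finset.sum_fiberwise Finset.univ T.edge, Finset.mul_sum]
  refine Finset.sum_congr rfl fun e _ => ?_
  conv_lhs => rw [← T.edge_out e]
  rw [T.sum_fiber, hg]
  ring

theorem bd₁_apply (b : T.Chain₁) (e : T.Edge) :
    T.bd₁ b e = - ∑ s : F × Fin 3 with T.edge s = e, T.inflow s b := by
  have h1 := sum_shift (fun s : F × Fin 3 => if T.edge s = e then b (s.1, s.2 + 2) else 0) 1
  have h2 := sum_shift (fun s : F × Fin 3 => if T.edge s = e then b (s.1, s.2 + 1) else 0) 2
  have e1 : ∀ j : Fin 3, j + 1 + 2 = j := by decide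
  have e2 : ∀ j : Fin 3, j + 2 + 1 = j := by decide
  simp only [e1, e2] at h1 h2
  simp only [bd₁, Fintype.linearCombination_apply, Finset.sum_apply, Pi.smul_apply, Pi.sub_apply,
    Pi.single_apply, smul_eq_mul, mul_sub, mul_ite, mul_one, mul_zero, Finset.sum_sub_distrib,
    inflow_apply, Finset.sum_filter]
  simp only [eq_comm (a := e)]
  simp only [Prod.mk.eta] at h1 h2
  rw [h1, h2]
  have h3 : ∀ s : F × Fin 3, (if T.edge s = e then b (s.1, s.2 + 1) - b (s.1, s.2 + 2) else 0) =
      (if T.edge s = e then b (s.1, s.2 + 1) else 0) -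
      (if T.edge s = e then b (s.1, s.2 + 2) else 0) := fun s => by split_ifs <;> ring
  ring

theorem mem_cycles (b : T.Chain₁) :
    b ∈ T.Cycles ↔ ∀ s, T.inflow (T.glue s) b = - T.inflow s b := by
  rw [LinearMap.mem_ker, funext_iff]
  constructor
  · intro h s
    have := h (T.edge s)
    rw [bd₁_apply, T.sum_fiber s fun s => T.inflow s b] at this
    simp only [Pi.zero_apply] at this
    linarith
  · intro h e
    rw [bd₁_apply, ← T.edge_out e, T.sum_fiber _ fun s => T.inflow s b, h]
    simp

theorem edgeCoeff_glue (z : T.Cycles) (s : F × Fin 3) :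
    T.edgeCoeff (T.glue s) z.1 = - T.edgeCoeff s z.1 := by
  have h := (T.mem_cycles z.1).1 z.2 s
  simp only [edgeCoeff_apply, inflow_apply, T.glue_glue] at *
  linarith

theorem two_interCycles (z w : T.Cycles) :
    2 * T.interCycles z w = ∑ s, T.edgeCoeff s z.1 * T.inflow s w.1 := by
  rw [T.sum_edges (fun s => T.edgeCoeff s z.1 * T.inflow s w.1) fun s => by
    rw [T.edgeCoeff_glue, (T.mem_cycles w.1).1 w.2 s]; ring]
  simp [interCycles]

theorem bd₂_apply (a : F → ℤ) (κ : F × Fin 3) : T.bd₂ a κ = a κ.1 := by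
  obtain ⟨t, i⟩ := κ
  simp only [bd₂, Fintype.linearCombination_apply, Finset.sum_apply, Pi.smul_apply,
    Pi.single_apply, Prod.mk.injEq, smul_eq_mul]
  rw [Finset.sum_eq_single t]
  · fin_cases i <;> simp [Fin.sum_univ_three]
  · intro b _ hb
    simp [hb.symm]
  · simp

/-- The two boundary maps form a complex. -/
theorem bd₁_bd₂ (a : F → ℤ) : T.bd₁ (T.bd₂ a) = 0 := by
  refine (T.mem_cycles _).2 fun s => ?_
  simp [inflow_apply, bd₂_apply]

theorem interCycles_left (n : T.Cycles) (hn : n ∈ T.Boundaries) (w : T.Cycles) :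
    T.interCycles n w = 0 := by
  obtain ⟨a, ha⟩ := hn
  have h := T.two_interCycles n w
  have ha' : n.1 = T.bd₂ a := ha.symm
  simp only [ha', edgeCoeff_apply, bd₂_apply, sub_mul, Finset.sum_sub_distrib] at h
  have h1 : ∑ s, a (T.glue s).1 * T.inflow s w.1 = - ∑ s, a s.1 * T.inflow s w.1 := by
    rw [← Equiv.sum_comp T.glue (fun s => a s.1 * T.inflow s w.1), ← Finset.sum_neg_distrib]
    refine Finset.sum_congr rfl fun s _ => ?_
    rw [(T.mem_cycles w.1).1 w.2 s]; ring
  have h2 : ∑ s, a s.1 * T.inflow s w.1 = 0 := by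
    rw [Fintype.sum_prod_type]
    refine Finset.sum_eq_zero fun t _ => ?_
    simp only [Fin.sum_univ_three, inflow_apply]
    have e1 : (2 : Fin 3) + 1 = 0 := rfl
    have e2 : (1 : Fin 3) + 2 = 0 := rfl
    have e3 : (2 : Fin 3) + 2 = 1 := rfl
    have e4 : (1 : Fin 3) + 1 = 2 := rfl
    simp only [e1, e2, e3, e4, zero_add]
    ring
  rw [h1, h2] at h
  linarith

theorem interCycles_right (n : T.Cycles) (hn : n ∈ T.Boundaries) (w : T.Cycles) :
    T.interCycles w n = 0 := by
  obtain ⟨a, ha⟩ := hn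
  have ha' : n.1 = T.bd₂ a := ha.symm
  have h := T.two_interCycles w n
  simp only [ha', inflow_apply, bd₂_apply] at h
  simpa using h

/-- The intersection form on `H₁(Σ; ℤ)`. -/
def inter : LinearMap.BilinForm ℤ T.H :=
  descendForm T.Boundaries T.interCycles T.interCycles_left T.interCycles_right

/-- The quantum torus `𝕋_q(H)`, for twice the intersection form. -/
abbrev TH (q : ℂˣ) : Type _ := QTorus q ((2 : ℤ) • T.inter)

/-! #### The lattice of punctures in `R_λ` and in `H` -/

theorem sum_count {A B S : Type*} [Fintype A] [Fintype B] [Fintype S] [DecidableEq A]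
    [DecidableEq B] (f : S → A) (g : S → B) (x : A → ℤ) (y : B → ℤ) :
    ∑ a, ∑ b, x a * ((Finset.univ.filter fun s : S => f s = a ∧ g s = b).card : ℤ) * y b =
      ∑ s, x (f s) * y (g s) := by
  simp only [Finset.card_filter, Nat.cast_sum, Nat.cast_ite, Nat.cast_one, Nat.cast_zero,
    Finset.mul_sum, Finset.sum_mul, ite_and]
  have h : ∀ a, ∑ b, ∑ s, x a * (if f s = a then if g s = b then (1 : ℤ) else 0 else 0) * y b =
      ∑ s, ∑ b, x a * (if f s = a then if g s = b then (1 : ℤ) else 0 else 0) * y b :=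
    fun a => Finset.sum_comm
  simp only [h]
  rw [Finset.sum_comm]
  refine Finset.sum_congr rfl fun s _ => ?_
  rw [Finset.sum_eq_single (f s), Finset.sum_eq_single (g s)]
  · simp
  · intro b _ hb; simp [hb.symm]
  · simp
  · intro a _ ha; simp [ha.symm]
  · simp

theorem epsForm_apply (x y : T.Edge → ℤ) : T.epsForm x y =
    ∑ s : F × Fin 3, (x (T.edge s) * y (T.edge (s.1, s.2 + 1)) -
      x (T.edge (s.1, s.2 + 1)) * y (T.edge s)) := by
  simp only [epsForm, Matrix.toBilin'_apply, Matrix.of_apply, eps, mul_sub, sub_mul,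
    Finset.sum_sub_distrib]
  rw [sum_count T.edge (fun s => T.edge (s.1, s.2 + 1)) x y]
  congr 1
  rw [← sum_count (fun s : F × Fin 3 => T.edge (s.1, s.2 + 1)) T.edge x y]
  refine Finset.sum_congr rfl fun a _ => Finset.sum_congr rfl fun b _ => ?_
  rw [Finset.filter_congr fun s _ => and_comm (a := T.edge s = b)]

theorem epsForm_swap (x y : T.Edge → ℤ) : T.epsForm x y = - T.epsForm y x := by
  rw [epsForm_apply, epsForm_apply, ← Finset.sum_neg_distrib]
  refine Finset.sum_congr rfl fun s _ => ?_
  ring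

theorem epsForm_one (y : T.Edge → ℤ) : T.epsForm 1 y = 0 := by
  rw [epsForm_apply]
  simp only [Pi.one_apply, one_mul, Finset.sum_sub_distrib]
  rw [sum_shift (fun s => y (T.edge s)) 1, sub_self]

theorem epsForm_zsmul_one (m : ℤ) (y : T.Edge → ℤ) : T.epsForm (m • 1) y = 0 := by
  rw [map_smul, LinearMap.smul_apply, epsForm_one, smul_zero]

/-- The form induced by `ε` on `R_λ`. -/
def epsR : LinearMap.BilinForm ℤ T.R :=
  descendForm _ T.epsForm
    (fun n hn m => by
      obtain ⟨a, rfl⟩ := Submodule.mem_span_singleton.1 hn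
      exact T.epsForm_zsmul_one a m)
    (fun n hn m => by
      obtain ⟨a, rfl⟩ := Submodule.mem_span_singleton.1 hn
      rw [epsForm_swap, epsForm_zsmul_one, neg_zero])

/-- The linear extension `ℤ^𝒫 → ℤ^λ` of `v ↦ c_v`. -/
def cMap : (T.Puncture → ℤ) →ₗ[ℤ] (T.Edge → ℤ) := Fintype.linearCombination ℤ T.c

theorem cMap_apply (n : T.Puncture → ℤ) (e : T.Edge) :
    T.cMap n e = ∑ s : F × Fin 3 with T.edge s = e, n (T.start s) := by
  simp only [cMap, Fintype.linearCombination_apply, Finset.sum_apply, Pi.smul_apply, c,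
    smul_eq_mul, Finset.card_filter, Nat.cast_sum, Nat.cast_ite, Nat.cast_one, Nat.cast_zero,
    Finset.mul_sum]
  rw [Finset.sum_comm, Finset.sum_filter]
  refine Finset.sum_congr rfl fun s _ => ?_
  rw [Finset.sum_eq_single (T.start s)]
  · simp
  · intro v _ hv; simp [hv.symm]
  · simp

theorem cMap_edge (n : T.Puncture → ℤ) (s : F × Fin 3) :
    T.cMap n (T.edge s) = n (T.start s) + n (T.finish s) := by
  rw [cMap_apply, T.sum_fiber s fun s => n (T.start s), T.start_glue]

theorem cMap_one : T.cMap 1 = (2 : ℤ) • 1 := by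
  ext e
  rw [← T.edge_out e, cMap_edge]
  rfl

theorem sum_start_finish (f : F × Fin 3 → ℤ) (hf : ∀ s, f (T.glue s) = f s)
    (n : T.Puncture → ℤ) :
    ∑ s, f s * n (T.start s) = ∑ s, f s * n (T.finish s) := by
  rw [← Equiv.sum_comp T.glue]
  exact Finset.sum_congr rfl fun s _ => by rw [hf, T.start_glue]

theorem epsForm_cMap (n : T.Puncture → ℤ) (y : T.Edge → ℤ) : T.epsForm (T.cMap n) y = 0 := by
  have e1 : ∀ j : Fin 3, j + 1 + 1 = j + 2 := by decide
  have e2 : ∀ j : Fin 3, j + 1 + 2 = j := by decide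
  have h1 := sum_shift (fun s => n (T.puncture (s.1, s.2 + 2 + 1)) * y (T.edge s)) 1
  have h2 := sum_shift (fun s => n (T.puncture (s.1, s.2 + 1)) * y (T.edge s)) 1
  have h := T.sum_start_finish (fun s => y (T.edge s)) (fun s => by rw [T.edge_glue]) n
  have e3 : ∀ j : Fin 3, j + 1 + 2 + 1 = j + 1 := by decide
  have e4 : ∀ j : Fin 3, j + 2 + 1 = j := by decide
  simp only [e1, e3, e4] at h1 h2
  rw [epsForm_apply]
  simp only [cMap_edge, start, finish, e1, e2, add_mul, Finset.sum_sub_distrib,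
    Finset.sum_add_distrib, h1, h2]
  simp only [start, finish, mul_comm (y _)] at h
  rw [h]
  ring

/-- The homomorphism `P_λ → R_λ` with `v ↦ c_v`. -/
def cP : T.P →ₗ[ℤ] T.R :=
  Submodule.mapQ _ _ T.cMap (by
    rw [Submodule.span_le, Set.singleton_subset_iff]
    rw [SetLike.mem_coe, Submodule.mem_comap, cMap_one]
    exact Submodule.smul_mem _ _ (Submodule.mem_span_singleton_self _))

theorem epsR_cP_left (p : T.P) (r : T.R) : T.epsR (T.cP p) r = 0 := by
  obtain ⟨n, rfl⟩ := Submodule.mkQ_surjective _ p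
  obtain ⟨y, rfl⟩ := Submodule.mkQ_surjective _ r
  exact T.epsForm_cMap n y

theorem gamma_mem (v : T.Puncture) :
    (∑ κ : F × Fin 3 with T.puncture κ = v, Pi.single κ 1 : T.Chain₁) ∈ T.Cycles := by
  rw [mem_cycles]
  have h : ∀ κ, (∑ κ : F × Fin 3 with T.puncture κ = v, Pi.single κ 1 : T.Chain₁) κ =
      if T.puncture κ = v then 1 else 0 := fun κ => by
    simp [Finset.sum_filter, Finset.sum_apply, Pi.single_apply]
  intro s
  rw [inflow_apply, inflow_apply, h, h, h, h]
  have h1 := T.start_glue s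
  have h2 := T.finish_glue s
  simp only [start, finish] at h1 h2
  rw [h1, h2]
  ring

/-- The small counterclockwise circle around the puncture `v`. -/
def gammaCycle (v : T.Puncture) : T.Cycles :=
  ⟨∑ κ : F × Fin 3 with T.puncture κ = v, Pi.single κ 1, T.gamma_mem v⟩

/-- The homology class `γ_v`. -/
def gamma (v : T.Puncture) : T.H := Submodule.Quotient.mk (T.gammaCycle v)

/-- The linear extension of `v ↦ gammaCycle v`. -/
def gammaMap : (T.Puncture → ℤ) →ₗ[ℤ] T.Cycles := Fintype.linearCombination ℤ T.gammaCycle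

theorem gammaMap_apply (n : T.Puncture → ℤ) (κ : F × Fin 3) :
    (T.gammaMap n).1 κ = n (T.puncture κ) := by
  simp only [gammaMap, Fintype.linearCombination_apply, gammaCycle, Submodule.coe_sum,
    Submodule.coe_smul, Finset.sum_apply, Pi.smul_apply, smul_eq_mul, Pi.single_apply,
    Finset.sum_filter, apply_ite (fun f : F × Fin 3 → ℤ => f κ), Pi.zero_apply]
  rw [Finset.sum_eq_single (T.puncture κ)]
  · rw [Finset.sum_eq_single κ]
    · simp
    · intro x _ hx
      simp [hx.symm]
    · simp
  · intro v _ hv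
    rw [Finset.sum_eq_zero, mul_zero]
    intro x _
    split_ifs with h1 h2
    · exact absurd (h2 ▸ h1).symm hv
    · rfl
    · rfl
  · simp

/-- The homomorphism `P_λ → H` with `v ↦ γ_v`. -/
def gammaP : T.P →ₗ[ℤ] T.H :=
  Submodule.mapQ _ _ T.gammaMap (by
    rw [Submodule.span_le, Set.singleton_subset_iff]
    refine ⟨1, ?_⟩
    ext κ
    exact (T.bd₂_apply 1 κ).trans (T.gammaMap_apply 1 κ).symm)

theorem inter_gammaP_left (p : T.P) (h : T.H) : T.inter (T.gammaP p) h = 0 := by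
  obtain ⟨n, rfl⟩ := Submodule.mkQ_surjective _ p
  obtain ⟨w, rfl⟩ := Submodule.mkQ_surjective _ h
  change T.interCycles (T.gammaMap n) w = 0
  have h := T.two_interCycles (T.gammaMap n) w
  rw [Finset.sum_eq_zero] at h
  · linarith
  · intro s _
    have h1 := T.finish_glue s
    simp only [start, finish] at h1
    rw [edgeCoeff_apply, gammaMap_apply, gammaMap_apply, h1]
    ring

theorem inter_gammaP_right (p : T.P) (h : T.H) : T.inter h (T.gammaP p) = 0 := by
  obtain ⟨n, rfl⟩ := Submodule.mkQ_surjective _ p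
  obtain ⟨w, rfl⟩ := Submodule.mkQ_surjective _ h
  change T.interCycles w (T.gammaMap n) = 0
  have h := T.two_interCycles w (T.gammaMap n)
  have h1 : ∑ s, T.edgeCoeff s w.1 * n (T.finish s) = - ∑ s, T.edgeCoeff s w.1 * n (T.start s) := by
    rw [← Equiv.sum_comp T.glue, ← Finset.sum_neg_distrib]
    exact Finset.sum_congr rfl fun s _ => by rw [T.edgeCoeff_glue, T.finish_glue]; ring
  have h2 : ∑ s, T.edgeCoeff s w.1 * n (T.start s) = 0 := by
    simp only [edgeCoeff_apply, sub_mul, Finset.sum_sub_distrib]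
    rw [← Equiv.sum_comp T.glue
      (fun s => w.1 ((T.glue s).1, (T.glue s).2 + 2) * n (T.start s))]
    simp only [T.glue_glue, T.start_glue, start, finish]
    simp only [← T.turn_finish, T.puncture_turn]
    rw [sum_shift (fun s => w.1 s * n (T.puncture s)) 2,
      sum_shift (fun s => w.1 s * n (T.puncture s)) 1, sub_self]
  have h3 : ∀ s, T.inflow s (T.gammaMap n).1 = n (T.start s) - n (T.finish s) := fun s => by
    rw [inflow_apply, gammaMap_apply, gammaMap_apply]; rfl
  simp only [h3, mul_sub, Finset.sum_sub_distrib, h1, h2] at h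
  linarith

/-! #### The algebras over `ℂ[P_λ]` -/

/-- The Chekhov--Fock algebra `𝕋^CF_q(λ)`. -/
abbrev TCF (q : ℂˣ) : Type _ := QTorus q T.epsForm

/-- The restricted Chekhov--Fock algebra `𝕋^CF_q(λ)/⟨X^𝟏 - 1⟩`. -/
def TCFr (q : ℂˣ) : Type _ :=
  RingQuot fun a b : T.TCF q => a = QTorus.X q T.epsForm 1 ∧ b = 1

instance (q : ℂˣ) : Ring (T.TCFr q) := inferInstanceAs (Ring (RingQuot _))
instance (q : ℂˣ) : Algebra ℂ (T.TCFr q) := inferInstanceAs (Algebra ℂ (RingQuot _))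

/-- The projection `𝕋^CF_q(λ) → 𝕋^CFr_q(λ)`. -/
def projCFr (q : ℂˣ) : T.TCF q →ₐ[ℂ] T.TCFr q :=
  RingQuot.mkAlgHom ℂ fun a b : T.TCF q => a = QTorus.X q T.epsForm 1 ∧ b = 1

theorem projCFr_surjective (q : ℂˣ) : Function.Surjective (T.projCFr q) :=
  RingQuot.mkAlgHom_surjective ℂ _

theorem projCFr_one (q : ℂˣ) : T.projCFr q (QTorus.X q T.epsForm 1) = 1 := by
  have h := RingQuot.mkAlgHom_rel ℂ
    (s := fun a b : T.TCF q => a = QTorus.X q T.epsForm 1 ∧ b = 1) ⟨rfl, rfl⟩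
  exact h.trans (map_one _)

theorem projCFr_zsmul (q : ℂˣ) (m : ℤ) :
    T.projCFr q (QTorus.X q T.epsForm (m • 1)) = 1 := by
  let f : Multiplicative ℤ →* T.TCFr q :=
    { toFun := fun m => T.projCFr q (QTorus.X q T.epsForm (m.toAdd • 1))
      map_one' := by simp [QTorus.X_zero]
      map_mul' := fun a b => by
        rw [← map_mul, QTorus.X_mul_X_of_radical _ _ _ _ (T.epsForm_zsmul_one _ _), toAdd_mul,
          add_smul] }
  have hf : f = 1 := MonoidHom.ext_mint (by simp [f, projCFr_one])
  exact DFunLike.congr_fun hf (Multiplicative.ofAdd m)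

/-- The monomial `X^r ∈ 𝕋^CFr_q(λ)` for `r ∈ R_λ`: the class of `X^k` for any representative
`k ∈ ℤ^λ` of `r`. -/
def monoCFr (q : ℂˣ) (r : T.R) : T.TCFr q :=
  Quotient.lift (fun k : T.Edge → ℤ => T.projCFr q (QTorus.X q T.epsForm k))
    (fun a b hab => by
      obtain ⟨m, hm⟩ := Submodule.mem_span_singleton.1 ((Submodule.quotientRel_def _).1 hab)
      have e : a = m • 1 + b := by rw [hm]; abel
      change T.projCFr q _ = T.projCFr q _
      rw [e, ← QTorus.X_mul_X_of_radical _ _ _ _ (T.epsForm_zsmul_one _ _), map_mul,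
        projCFr_zsmul, one_mul]) r

theorem monoCFr_mk (q : ℂˣ) (k : T.Edge → ℤ) :
    T.monoCFr q (Submodule.Quotient.mk k) = T.projCFr q (QTorus.X q T.epsForm k) := rfl

theorem monoCFr_cP_mul (q : ℂˣ) (p : T.P) (r : T.R) :
    T.monoCFr q (T.cP p) * T.monoCFr q r = T.monoCFr q (T.cP p + r) := by
  obtain ⟨n, rfl⟩ := Submodule.mkQ_surjective _ p
  obtain ⟨y, rfl⟩ := Submodule.mkQ_surjective _ r
  change T.projCFr q (QTorus.X q T.epsForm (T.cMap n)) * T.projCFr q (QTorus.X q T.epsForm y) =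
    T.projCFr q (QTorus.X q T.epsForm (T.cMap n + y))
  rw [← map_mul, QTorus.X_mul_X_of_radical _ _ _ _ (T.epsForm_cMap n y)]

theorem monoCFr_cP_central (q : ℂˣ) (p : T.P) (f : T.TCFr q) :
    Commute (T.monoCFr q (T.cP p)) f := by
  obtain ⟨n, rfl⟩ := Submodule.mkQ_surjective _ p
  obtain ⟨f, rfl⟩ := T.projCFr_surjective q f
  exact (QTorus.X_central q T.epsForm (T.cMap n) (T.epsForm_cMap n)
    (fun m => by rw [epsForm_swap, epsForm_cMap, neg_zero]) f).map (T.projCFr q)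

/-- The group algebra `ℂ[P_λ]`. -/
abbrev CP : Type _ := AddMonoidAlgebra ℂ T.P

/-- The homomorphism `ℂ[P_λ] → 𝕋^CFr_q(λ)` with `v ↦ X^{c_v}`. -/
def toCFr (q : ℂˣ) : T.CP →ₐ[ℂ] T.TCFr q :=
  AddMonoidAlgebra.lift ℂ (T.TCFr q) T.P
    { toFun := fun p => T.monoCFr q (T.cP p.toAdd)
      map_one' := by
        rw [toAdd_one, map_zero]
        exact (T.monoCFr_mk q 0).trans (by rw [QTorus.X_zero, map_one])
      map_mul' := fun a b => by rw [monoCFr_cP_mul, toAdd_mul, map_add] }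

/-- The homomorphism `ℂ[P_λ] → 𝕋_q(H)` with `v ↦ x^{γ_v}`. -/
def toTH (q : ℂˣ) : T.CP →ₐ[ℂ] T.TH q :=
  AddMonoidAlgebra.lift ℂ (T.TH q) T.P
    { toFun := fun p => QTorus.X q _ (T.gammaP p.toAdd)
      map_one' := by rw [toAdd_one, map_zero]; rfl
      map_mul' := fun a b => by
        rw [QTorus.X_mul_X_of_radical, toAdd_mul, map_add]
        simp [inter_gammaP_left] }

theorem toCFr_central (q : ℂˣ) (a : T.CP) (f : T.TCFr q) : Commute (T.toCFr q a) f := by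
  induction a using AddMonoidAlgebra.induction_on with
  | of p => simpa [toCFr] using T.monoCFr_cP_central q p f
  | add a b ha hb => rw [map_add]; exact ha.add_left hb
  | smul r a ha => rw [map_smul]; exact ha.smul_left r

theorem toTH_central (q : ℂˣ) (a : T.CP) (f : T.TH q) : Commute (T.toTH q a) f := by
  induction a using AddMonoidAlgebra.induction_on with
  | of p =>
    simpa [toTH] using QTorus.X_central q _ (T.gammaP p)
      (fun m => by simp [inter_gammaP_left]) (fun m => by simp [inter_gammaP_right]) f
  | add a b ha hb => rw [map_add]; exact ha.add_left hb
  | smul r a ha => rw [map_smul]; exact ha.smul_left r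

instance (q : ℂˣ) : Algebra T.CP (T.TCFr q) :=
  (T.toCFr q).toRingHom.toAlgebra' (fun a f => T.toCFr_central q a f)

instance (q : ℂˣ) : Algebra T.CP (T.TH q) :=
  (T.toTH q).toRingHom.toAlgebra' (fun a f => T.toTH_central q a f)

instance (q : ℂˣ) : IsScalarTower ℂ T.CP (T.TCFr q) :=
  IsScalarTower.of_algebraMap_eq fun r => ((T.toCFr q).commutes r).symm

instance (q : ℂˣ) : IsScalarTower ℂ T.CP (T.TH q) :=
  IsScalarTower.of_algebraMap_eq fun r => ((T.toTH q).commutes r).symm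

/-! #### The maps into the Kashaev lattice -/

theorem sum_sideGen (t : F) : ∑ i : Fin 3, T.sideGen (t, i) = 0 := by
  have h1 : ∑ i : Fin 3, (Pi.single i 1 : Fin 3 → ℤ) = 1 := by
    ext j; fin_cases j <;> simp
  have h2 : ∑ i : Fin 3, (Submodule.Quotient.mk (Pi.single i 1) : FaceLattice) = 0 := by
    have := map_sum (Submodule.mkQ (Submodule.span ℤ {(1 : Fin 3 → ℤ)}))
      (fun i => (Pi.single i 1 : Fin 3 → ℤ)) Finset.univ
    rw [h1] at this
    refine (this.symm.trans ?_ : _)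
    exact (Submodule.Quotient.mk_eq_zero _).2 (Submodule.mem_span_singleton_self _)
  have h3 := map_sum (LinearMap.single ℤ (fun _ : F => FaceLattice) t)
    (fun i : Fin 3 => (Submodule.Quotient.mk (Pi.single i 1) : FaceLattice)) Finset.univ
  rw [h2, map_zero] at h3
  exact h3.symm

/-- The map `i_H`: a segment around a corner goes to the generator on the side opposite
to that corner, with the sign `+` if the segment is clockwise and `-` if it is counterclockwise. -/
def iH : T.H →ₗ[ℤ] T.L :=
  T.Boundaries.liftQ
    (Fintype.linearCombination ℤ (fun κ : F × Fin 3 => - T.sideGen κ) ∘ₗ T.Cycles.subtype)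
    (by
      rintro n ⟨a, ha⟩
      have ha' : n.1 = T.bd₂ a := ha.symm
      rw [LinearMap.mem_ker, LinearMap.comp_apply, Submodule.subtype_apply, ha',
        Fintype.linearCombination_apply, Fintype.sum_prod_type]
      refine Finset.sum_eq_zero fun t _ => ?_
      simp only [bd₂_apply, ← Finset.smul_sum, Finset.sum_neg_distrib]
      rw [T.sum_sideGen t]; simp)

/-- The map `i_CFr`: an edge goes to the sum of its two sides in the adjacent faces. -/
def iCFr : T.R →ₗ[ℤ] T.L :=
  (Submodule.span ℤ {(1 : T.Edge → ℤ)}).liftQ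
    (Fintype.linearCombination ℤ fun e : T.Edge =>
      ∑ s : F × Fin 3 with T.edge s = e, T.sideGen s)
    (by
      rw [Submodule.span_le, Set.singleton_subset_iff]
      change Fintype.linearCombination ℤ _ (1 : T.Edge → ℤ) = 0
      rw [Fintype.linearCombination_apply]
      simp only [Pi.one_apply, one_smul]
      rw [Finset.sum_fiberwise, Fintype.sum_prod_type]
      exact Finset.sum_eq_zero fun t _ => T.sum_sideGen t)

/-- The subgroup of `R_λ ⊕ H` generated by the elements `c_v - γ_v`. -/
def amalgam : Submodule ℤ (T.R × T.H) :=
  Submodule.span ℤ (Set.range fun v : T.Puncture =>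
    ((Submodule.Quotient.mk (T.c v), - T.gamma v) : T.R × T.H))

end IdealTriangulation

end

noncomputable section

namespace IdealTriangulation

variable {F : Type*} [Fintype F] [DecidableEq F] (T : IdealTriangulation F)

/-! ### The maps into the Kashaev lattice in coordinates -/

/-! Everything is computed in integer functions on sides, equivalently on opposite corners, taken
modulo constants on each face. In these coordinates `iCFr` sends `x` to its values on the sides of
every face, and `iH` sends a cycle `z` to `-z`. Hence `iCFr x = 0` says that `x` is constant on each
face, so globally constant by connectedness, and `iH z = 0` says that `z` is constant on each face,
so a boundary.

For the amalgam, suppose `iCFr x + iH z = 0`. Then `x` agrees with `z` up to a constant on each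
face, so `x`, read as a function of corners, satisfies the cycle condition. This forces `x` to be a
combination of the `c_v` plus a constant (`exists_cMap_of_cycle`): the number attached to a corner
by adding `x` on its two sides and subtracting `x` on the opposite side depends only on the
puncture, and its parity is the same everywhere. Since `iCFr` and `iH` agree on `P_λ` (`iCFr_cP`),
injectivity of `iH` then identifies the class of `z`.

The forms match because a cycle's flow through a side changes sign under gluing. Pairing it with the
gluing-invariant values of `x` gives zero, so `R_λ` and `H` are orthogonal; pairing two cycles gives
the intersection sum after regrouping by faces.

For the algebras, the Kashaev form is pulled back to the amalgamated lattice. Its quantum torus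
embeds in the Kashaev algebra because the lattice map is injective. The tensor product embeds in
this intermediate torus by `X^r ⊗ x^h ↦ x^{[r,h]}`, with a left inverse that exists because
tensoring over `ℂ[P_λ]` imposes the relations `c_v = γ_v` on monomials (`tmul_eq_of_mem_amalgam`).
-/

theorem sum_smul_sideGen (a : F × Fin 3 → ℤ) (t : F) :
    (∑ κ, a κ • T.sideGen κ : T.L) t = Submodule.Quotient.mk (fun i => a (t, i)) := by
  rw [Finset.sum_apply, Fintype.sum_prod_type, Finset.sum_eq_single t]
  · have h := map_sum (Submodule.mkQ (Submodule.span ℤ {(1 : Fin 3 → ℤ)}))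
      (fun i => a (t, i) • (Pi.single i 1 : Fin 3 → ℤ)) Finset.univ
    rw [← pi_eq_sum_univ' fun i => a (t, i)] at h
    refine Eq.trans ?_ h.symm
    refine Finset.sum_congr rfl fun i _ => ?_
    rw [map_smul]
    simp only [sideGen, Pi.smul_apply, Pi.single_eq_same]
    rfl
  · intro b _ hb
    refine Finset.sum_eq_zero fun i _ => ?_
    simp [sideGen, hb.symm]
  · simp

theorem iCFr_mk (x : T.Edge → ℤ) (t : F) :
    T.iCFr (Submodule.Quotient.mk x) t = Submodule.Quotient.mk (fun i => x (T.edge (t, i))) := by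
  rw [← T.sum_smul_sideGen (fun κ => x (T.edge κ))]
  change (Fintype.linearCombination ℤ
    (fun e : T.Edge => ∑ s : F × Fin 3 with T.edge s = e, T.sideGen s) x : T.L) t = _
  rw [Fintype.linearCombination_apply, ← Finset.sum_fiberwise Finset.univ T.edge]
  refine congrFun (Finset.sum_congr rfl fun e _ => ?_) t
  rw [Finset.smul_sum]
  refine Finset.sum_congr rfl fun s hs => ?_
  rw [(Finset.mem_filter.1 hs).2]

theorem iH_mk (z : T.Cycles) (t : F) :
    T.iH (Submodule.Quotient.mk z) t = Submodule.Quotient.mk (fun i => - z.1 (t, i)) := by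
  rw [← T.sum_smul_sideGen (fun κ => - z.1 κ)]
  change (Fintype.linearCombination ℤ (M := T.L) (fun κ : F × Fin 3 => - T.sideGen κ) z.1) t = _
  rw [Fintype.linearCombination_apply]
  simp only [smul_neg, neg_smul]

theorem faceLattice_mk_eq_zero {x : Fin 3 → ℤ}
    (h : (Submodule.Quotient.mk x : FaceLattice) = 0) : ∃ a : ℤ, ∀ i, x i = a := by
  obtain ⟨a, ha⟩ := Submodule.mem_span_singleton.1 ((Submodule.Quotient.mk_eq_zero _).1 h)
  exact ⟨a, fun i => by rw [← ha]; simp⟩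

/-- A function of the faces that agrees on adjacent faces is constant. -/
theorem eq_of_adjacent {α : Type*} (f : F → α) (hf : ∀ s, f (T.glue s).1 = f s.1) (t t' : F) :
    f t = f t' := by
  induction T.connected t t' with
  | refl => rfl
  | @tail b _ _ h ih =>
    obtain ⟨i, j, hij⟩ := h
    have := hf (b, i)
    rw [hij] at this
    rw [ih, ← this]

/-! ### Injectivity -/

theorem iCFr_injective : Function.Injective T.iCFr := by
  rw [injective_iff_map_eq_zero]
  intro r hr
  obtain ⟨x, rfl⟩ := Submodule.mkQ_surjective _ r
  have h : ∀ t, ∃ a : ℤ, ∀ i, x (T.edge (t, i)) = a := fun t =>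
    faceLattice_mk_eq_zero ((T.iCFr_mk x t).symm.trans (congrFun hr t))
  choose a ha using h
  obtain ⟨t₀⟩ := T.nonempty
  have hconst := T.eq_of_adjacent a fun s => by
    rw [← ha s.1 s.2, ← ha _ (T.glue s).2, Prod.mk.eta, Prod.mk.eta, T.edge_glue]
  refine (Submodule.Quotient.mk_eq_zero _).2 (Submodule.mem_span_singleton.2 ⟨a t₀, ?_⟩)
  ext e
  rw [← T.edge_out e, ← Prod.mk.eta (p := Quotient.out e), ha, hconst _ t₀]
  simp [hconst t₀ (Quotient.out e).1]

/-- The 2-chain `a` bounds such a cycle, since `bd₂` spreads the coefficient of a face over its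
three corners. -/
theorem mk_cycle_eq_zero (z : T.Cycles) (a : F → ℤ) (h : ∀ κ, z.1 κ = a κ.1) :
    (Submodule.Quotient.mk z : T.H) = 0 := by
  refine (Submodule.Quotient.mk_eq_zero _).2 ⟨a, ?_⟩
  ext κ
  rw [bd₂_apply, Submodule.subtype_apply, h]

theorem iH_injective : Function.Injective T.iH := by
  rw [injective_iff_map_eq_zero]
  intro r hr
  obtain ⟨z, rfl⟩ := Submodule.mkQ_surjective _ r
  have h : ∀ t, ∃ a : ℤ, ∀ i, - z.1 (t, i) = a := fun t =>
    faceLattice_mk_eq_zero ((T.iH_mk z t).symm.trans (congrFun hr t))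
  choose a ha using h
  exact T.mk_cycle_eq_zero z (fun t => - a t) fun κ => by rw [← ha κ.1 κ.2]; simp

/-- The two ends of a side are the two corners not opposite to it. Thus the value on that side is
the sum over all three corners minus the value at the opposite corner, and the sum is killed in
`ℤ³/ℤ𝟏`. -/
theorem iCFr_cP (p : T.P) : T.iCFr (T.cP p) = T.iH (T.gammaP p) := by
  obtain ⟨n, rfl⟩ := Submodule.mkQ_surjective _ p
  ext t
  refine (T.iCFr_mk (T.cMap n) t).trans (Eq.trans ?_ (T.iH_mk (T.gammaMap n) t).symm)
  rw [← sub_eq_zero, ← Submodule.Quotient.mk_sub, Submodule.Quotient.mk_eq_zero]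
  refine Submodule.mem_span_singleton.2 ⟨∑ i, n (T.puncture (t, i)), ?_⟩
  ext i
  simp only [Pi.smul_apply, Pi.one_apply, Pi.sub_apply, cMap_edge, gammaMap_apply, start, finish,
    Fin.sum_univ_three]
  fin_cases i <;> simp <;> ring

theorem cP_mk_single (v : T.Puncture) :
    T.cP (Submodule.Quotient.mk (Pi.single v 1)) = Submodule.Quotient.mk (T.c v) := by
  change Submodule.Quotient.mk (T.cMap (Pi.single v 1)) = _
  simp [cMap]

theorem gammaP_mk_single (v : T.Puncture) :
    T.gammaP (Submodule.Quotient.mk (Pi.single v 1)) = T.gamma v := by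
  change Submodule.Quotient.mk (T.gammaMap (Pi.single v 1)) = _
  simp [gammaMap, gamma]

/-- The generators of `amalgam` are the values of one linear map on the standard basis of `ℤ^𝒫`.
Together with `amalgam_le`, this lets `amalgam` be handled as the image of `P_λ`. -/
theorem cP_neg_gammaP_mem (p : T.P) : ((T.cP p, - T.gammaP p) : T.R × T.H) ∈ T.amalgam := by
  obtain ⟨n, rfl⟩ := Submodule.mkQ_surjective _ p
  let f : (T.Puncture → ℤ) →ₗ[ℤ] T.R × T.H :=
    (T.cP.prod (- T.gammaP)) ∘ₗ Submodule.mkQ _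
  change f n ∈ T.amalgam
  rw [pi_eq_sum_univ' n, map_sum]
  refine Submodule.sum_mem _ fun v _ => ?_
  rw [map_smul]
  refine Submodule.smul_mem _ _ (Submodule.subset_span ⟨v, ?_⟩)
  change _ = (T.cP (Submodule.Quotient.mk (Pi.single v 1)),
    - T.gammaP (Submodule.Quotient.mk (Pi.single v 1)))
  rw [cP_mk_single, gammaP_mk_single]

theorem amalgam_le {N : Submodule ℤ (T.R × T.H)}
    (h : ∀ p : T.P, ((T.cP p, - T.gammaP p) : T.R × T.H) ∈ N) : T.amalgam ≤ N := by
  refine Submodule.span_le.2 ?_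
  rintro _ ⟨v, rfl⟩
  have := h (Submodule.Quotient.mk (Pi.single v 1))
  rwa [cP_mk_single, gammaP_mk_single] at this

/-- The lattice `(R_λ ⊕ H)/⟨c_v = γ_v⟩`. -/
abbrev Amalgam : Type _ := (T.R × T.H) ⧸ T.amalgam

/-- The map `i`. -/
def iAmalgam : T.Amalgam →ₗ[ℤ] T.L :=
  T.amalgam.liftQ (T.iCFr.coprod T.iH) (T.amalgam_le fun p => by
    rw [LinearMap.mem_ker, LinearMap.coprod_apply, map_neg, iCFr_cP, add_neg_cancel])

theorem iAmalgam_mk (r : T.R) (h : T.H) :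
    T.iAmalgam (Submodule.Quotient.mk (r, h)) = T.iCFr r + T.iH h := rfl

/-- Vectors in `ℤ^λ` that satisfy the cycle condition as functions of the corners are, up to
`ℤ𝟏`, combinations of the vectors `c_v`. -/
theorem exists_cMap_of_cycle (x : T.Edge → ℤ)
    (hx : ∀ s : F × Fin 3,
      x (T.edge ((T.glue s).1, (T.glue s).2 + 1)) - x (T.edge ((T.glue s).1, (T.glue s).2 + 2)) =
        - (x (T.edge (s.1, s.2 + 1)) - x (T.edge (s.1, s.2 + 2)))) :
    ∃ (n : T.Puncture → ℤ) (a : ℤ), ∀ e, x e = T.cMap n e + a := by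
  -- If `x = cMap n + a`, then `m κ = 2 * n (puncture κ) + a`; so `n` and `a` are to be recovered
  -- from `m`.
  let m : F × Fin 3 → ℤ := fun κ =>
    x (T.edge (κ.1, κ.2 + 1)) + x (T.edge (κ.1, κ.2 + 2)) - x (T.edge κ)
  have e1 : ∀ j : Fin 3, j + 1 + 1 = j + 2 := by decide
  have e2 : ∀ j : Fin 3, j + 1 + 2 = j := by decide
  have e3 : ∀ j : Fin 3, j + 2 + 2 = j + 1 := by decide
  have e4 : ∀ j : Fin 3, j + 2 + 1 = j := by decide
  -- This is the cycle condition at the side crossed by the turn, whose own edge contributes equally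
  -- to both sides.
  have hturn : ∀ κ, m (T.turn κ) = m κ := fun κ => by
    have h := hx (κ.1, κ.2 + 1)
    have hg := T.edge_glue (κ.1, κ.2 + 1)
    change x (T.edge (_, (T.glue (κ.1, κ.2 + 1)).2 + 1 + 1)) +
      x (T.edge (_, (T.glue (κ.1, κ.2 + 1)).2 + 1 + 2)) -
      x (T.edge (_, (T.glue (κ.1, κ.2 + 1)).2 + 1)) = x _ + x _ - x (T.edge (κ.1, κ.2))
    simp only [e1, e2, Prod.mk.eta] at h ⊢
    change x (T.edge ((T.glue (κ.1, κ.2 + 1)).1, _)) + x (T.edge (T.glue (κ.1, κ.2 + 1))) -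
      x (T.edge ((T.glue (κ.1, κ.2 + 1)).1, _)) = _
    rw [hg]
    linarith
  obtain ⟨t₀⟩ := T.nonempty
  -- Modulo 2, `m κ` is the sum of `x` over the sides of the face, so its parity depends only on the
  -- face. Adjacent faces contain corners related by `turn`, so connectedness makes the parity
  -- global.
  have hpar : ∀ κ, m κ % 2 = m (t₀, 0) % 2 := by
    let σ : F → ℤ := fun t => (∑ i, x (T.edge (t, i))) % 2
    have hσ : ∀ κ, m κ % 2 = σ κ.1 := by
      rintro ⟨t, i⟩
      simp only [m, σ, Fin.sum_univ_three]
      fin_cases i <;> simp <;> omega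
    have hadj : ∀ s, σ (T.glue s).1 = σ s.1 := fun s => by
      have h := hturn (s.1, s.2 + 2)
      rw [T.turn_finish] at h
      rw [← hσ ((T.glue s).1, (T.glue s).2 + 1), h, hσ]
    intro κ
    rw [hσ, hσ]
    exact T.eq_of_adjacent σ hadj _ _
  have hcyc : ∀ κ κ', T.turn.SameCycle κ κ' → m κ = m κ' := by
    rintro κ _ ⟨k, rfl⟩
    induction k using Int.induction_on with
    | zero => rfl
    | succ k ih => rw [add_comm, zpow_add, zpow_one, Equiv.Perm.mul_apply, hturn, ih]
    | pred k ih =>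
      rw [ih, ← hturn ((T.turn ^ (-(k : ℤ) - 1)) κ), ← Equiv.Perm.mul_apply, ← zpow_one_add]
      congr 3
      ring
  let n : T.Puncture → ℤ := fun v => Quotient.lift (fun κ => m κ / 2)
    (fun κ κ' h => by rw [hcyc κ κ' h]) v
  have hn : ∀ κ, n (T.puncture κ) = m κ / 2 := fun κ => rfl
  -- The values of `m` at the two ends of an edge sum to `2 * x e`. Halving each loses the common
  -- remainder, once per end, so after division by 2 exactly one remainder is left over.
  refine ⟨n, m (t₀, 0) % 2, fun e => ?_⟩
  rw [← T.edge_out e, cMap_edge, start, finish, hn, hn]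
  generalize (Quotient.out e : F × Fin 3) = s
  have h1 := hpar (s.1, s.2 + 1)
  have h2 := hpar (s.1, s.2 + 2)
  have h3 : m (s.1, s.2 + 1) + m (s.1, s.2 + 2) = 2 * x (T.edge s) := by
    simp only [m, e1, e2, e3, e4, Prod.mk.eta]
    ring
  omega

theorem iAmalgam_injective : Function.Injective T.iAmalgam := by
  rw [injective_iff_map_eq_zero]
  intro u hu
  obtain ⟨⟨r, h⟩, rfl⟩ := Submodule.mkQ_surjective _ u
  obtain ⟨x, rfl⟩ := Submodule.mkQ_surjective _ r
  obtain ⟨z, rfl⟩ := Submodule.mkQ_surjective _ h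
  have hface : ∀ t, ∃ a : ℤ, ∀ i, x (T.edge (t, i)) - z.1 (t, i) = a := fun t =>
    faceLattice_mk_eq_zero (by
      have := congrFun hu t
      change T.iCFr (Submodule.Quotient.mk x) t + T.iH (Submodule.Quotient.mk z) t = 0 at this
      rw [iCFr_mk, iH_mk, ← Submodule.Quotient.mk_add] at this
      exact this)
  choose a ha using hface
  have ha' : ∀ κ : F × Fin 3, x (T.edge κ) = z.1 κ + a κ.1 := fun κ => by
    have := ha κ.1 κ.2
    rw [Prod.mk.eta] at this
    linarith
  -- The cycle condition involves only differences within a face, so the constants `a` cancel and it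
  -- passes from `z` to `x`.
  obtain ⟨n, b, hn⟩ := T.exists_cMap_of_cycle x fun s => by
    have := (T.mem_cycles z.1).1 z.2 s
    simp only [inflow_apply] at this
    simp only [ha']
    linarith
  have hr : (Submodule.Quotient.mk x : T.R) = T.cP (Submodule.Quotient.mk n) := by
    refine (Submodule.Quotient.eq _).2 (Submodule.mem_span_singleton.2 ⟨b, ?_⟩)
    ext e
    simp [hn e]
  have hh : T.iH (Submodule.Quotient.mk z) = T.iH (- T.gammaP (Submodule.Quotient.mk n)) := by
    rw [map_neg, ← iCFr_cP, ← hr, eq_neg_iff_add_eq_zero, add_comm]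
    exact hu
  refine (Submodule.Quotient.mk_eq_zero _).2 ?_
  change ((Submodule.Quotient.mk x : T.R), (Submodule.Quotient.mk z : T.H)) ∈ _
  rw [hr, T.iH_injective hh]
  exact T.cP_neg_gammaP_mem _

/-! ### Compatibility with the forms -/

/-- In this form the factor multiplying `a s` is exactly `inflow s b`, which links the Kashaev form
to cycles. -/
theorem kashaevForm_mk (a b : F × Fin 3 → ℤ) (f g : T.L)
    (hf : ∀ t, f t = Submodule.Quotient.mk fun i => a (t, i))
    (hg : ∀ t, g t = Submodule.Quotient.mk fun i => b (t, i)) :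
    T.kashaevForm f g = ∑ s : F × Fin 3, a s * (b (s.1, s.2 + 1) - b (s.1, s.2 + 2)) := by
  rw [Fintype.sum_prod_type]
  simp only [kashaevForm, LinearMap.sum_apply, LinearMap.compl₁₂_apply, LinearMap.proj_apply,
    hf, hg]
  refine Finset.sum_congr rfl fun t _ => ?_
  change faceForm₀ (fun i => a (t, i)) (fun i => b (t, i)) = _
  rw [faceForm₀_apply]
  have e1 : (2 : Fin 3) + 1 = 0 := rfl
  have e2 : (1 : Fin 3) + 2 = 0 := rfl
  have e3 : (2 : Fin 3) + 2 = 1 := rfl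
  have e4 : (1 : Fin 3) + 1 = 2 := rfl
  simp only [Fin.sum_univ_three, e1, e2, e3, e4, zero_add]
  ring

theorem kashaevForm_swap (f g : T.L) : T.kashaevForm f g = - T.kashaevForm g f := by
  simp only [kashaevForm, LinearMap.sum_apply, LinearMap.compl₁₂_apply, LinearMap.proj_apply,
    ← Finset.sum_neg_distrib]
  refine Finset.sum_congr rfl fun t _ => ?_
  obtain ⟨x, hx⟩ := Submodule.mkQ_surjective _ (f t)
  obtain ⟨y, hy⟩ := Submodule.mkQ_surjective _ (g t)
  rw [← hx, ← hy]
  change faceForm₀ x y = - faceForm₀ y x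
  rw [faceForm₀_apply, faceForm₀_apply]
  ring

theorem kashaevForm_iCFr (r r' : T.R) : T.kashaevForm (T.iCFr r) (T.iCFr r') = T.epsR r r' := by
  obtain ⟨x, rfl⟩ := Submodule.mkQ_surjective _ r
  obtain ⟨y, rfl⟩ := Submodule.mkQ_surjective _ r'
  refine (T.kashaevForm_mk (fun s => x (T.edge s)) (fun s => y (T.edge s)) _ _
    (T.iCFr_mk x) (T.iCFr_mk y)).trans (Eq.trans ?_ (T.epsForm_apply x y).symm)
  have h := sum_shift (fun s => x (T.edge s) * y (T.edge (s.1, s.2 + 2))) 1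
  have e2 : ∀ j : Fin 3, j + 1 + 2 = j := by decide
  simp only [e2, Prod.mk.eta] at h
  simp only [mul_sub, Finset.sum_sub_distrib, h]

theorem sum_inflow_of_glue (z : T.Cycles) (f : F × Fin 3 → ℤ) (hf : ∀ s, f (T.glue s) = f s) :
    ∑ s, f s * T.inflow s z.1 = 0 := by
  have h : ∑ s, f s * T.inflow s z.1 = - ∑ s, f s * T.inflow s z.1 := by
    conv_lhs => rw [← Equiv.sum_comp T.glue]
    rw [← Finset.sum_neg_distrib]
    exact Finset.sum_congr rfl fun s _ => by rw [hf, (T.mem_cycles z.1).1 z.2 s]; ring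
  linarith

/-- The two sides of an edge carry the same value of `x` but opposite flows of the cycle, so their
contributions cancel. -/
theorem kashaevForm_iCFr_iH (r : T.R) (h : T.H) : T.kashaevForm (T.iCFr r) (T.iH h) = 0 := by
  obtain ⟨x, rfl⟩ := Submodule.mkQ_surjective _ r
  obtain ⟨z, rfl⟩ := Submodule.mkQ_surjective _ h
  refine (T.kashaevForm_mk (fun s => x (T.edge s)) (fun s => - z.1 s) _ _
    (T.iCFr_mk x) (T.iH_mk z)).trans ?_
  rw [← T.sum_inflow_of_glue z (fun s => - x (T.edge s)) fun s => by rw [T.edge_glue]]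
  exact Finset.sum_congr rfl fun s _ => by rw [inflow_apply]; ring

theorem kashaevForm_iH (h h' : T.H) : T.kashaevForm (T.iH h) (T.iH h') = 2 * T.inter h h' := by
  obtain ⟨z, rfl⟩ := Submodule.mkQ_surjective _ h
  obtain ⟨w, rfl⟩ := Submodule.mkQ_surjective _ h'
  refine (T.kashaevForm_mk (fun s => - z.1 s) (fun s => - w.1 s) _ _
    (T.iH_mk z) (T.iH_mk w)).trans (Eq.trans ?_ (T.two_interCycles z w).symm)
  -- Gluing moves the corner of the neighbouring face back to the face of `s`. Each face then
  -- carries minus the values of `z` at the two corners adjacent to `s`; as the flow into a face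
  -- sums to zero, these can be replaced by the value at the opposite corner.
  have h1 : ∑ s, z.1 ((T.glue s).1, (T.glue s).2 + 2) * T.inflow s w.1 =
      - ∑ s, z.1 (s.1, s.2 + 2) * T.inflow s w.1 := by
    rw [← Equiv.sum_comp T.glue (fun s => z.1 (s.1, s.2 + 2) * T.inflow s w.1),
      ← Finset.sum_neg_distrib]
    exact Finset.sum_congr rfl fun s _ => by rw [(T.mem_cycles w.1).1 w.2 s]; ring
  simp only [edgeCoeff_apply, sub_mul, Finset.sum_sub_distrib, h1]
  rw [← Finset.sum_neg_distrib, ← Finset.sum_sub_distrib, Fintype.sum_prod_type,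
    Fintype.sum_prod_type]
  refine Finset.sum_congr rfl fun t _ => ?_
  have e1 : (2 : Fin 3) + 1 = 0 := rfl
  have e2 : (1 : Fin 3) + 2 = 0 := rfl
  have e3 : (2 : Fin 3) + 2 = 1 := rfl
  have e4 : (1 : Fin 3) + 1 = 2 := rfl
  simp only [Fin.sum_univ_three, inflow_apply, e1, e2, e3, e4, zero_add]
  ring

theorem kashaevForm_iAmalgam (r r' : T.R) (h h' : T.H) :
    T.kashaevForm (T.iAmalgam (Submodule.Quotient.mk (r, h)))
      (T.iAmalgam (Submodule.Quotient.mk (r', h'))) = T.epsR r r' + 2 * T.inter h h' := by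
  rw [iAmalgam_mk, iAmalgam_mk, map_add T.kashaevForm, LinearMap.add_apply, map_add, map_add,
    kashaevForm_iCFr, kashaevForm_iCFr_iH, kashaevForm_iH, T.kashaevForm_swap (T.iH h),
    kashaevForm_iCFr_iH]
  ring

end IdealTriangulation

/-! ### Functoriality of quantum tori -/

namespace QTorus

variable {L L' : Type*} [AddCommGroup L] [AddCommGroup L'] (q : ℂˣ)
  {ω : LinearMap.BilinForm ℤ L} {ω' : LinearMap.BilinForm ℤ L'}

/-- The linear map from a quantum torus with given values on the monomials. -/
def lift (ω : LinearMap.BilinForm ℤ L) {M : Type*} [AddCommGroup M] [Module ℂ M] (φ : L → M) :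
    QTorus q ω →ₗ[ℂ] M :=
  Finsupp.linearCombination ℂ φ

theorem lift_X {M : Type*} [AddCommGroup M] [Module ℂ M] (φ : L → M) (k : L) :
    lift q ω φ (X q ω k) = φ k :=
  (Finsupp.linearCombination_single ℂ (1 : ℂ) k).trans (one_smul ℂ _)

/-- A homomorphism of lattices that respects the forms induces a homomorphism of quantum tori. -/
def map (f : L →ₗ[ℤ] L') (hf : ∀ a b, ω' (f a) (f b) = ω a b) : QTorus q ω →ₐ[ℂ] QTorus q ω' :=
  AlgHom.ofLinearMap (lift q ω fun k => X q ω' (f k))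
    (by rw [one_def, lift_X, map_zero, X_zero])
    (fun u v => by
      induction u using QTorus.induction with
      | h0 => simp
      | hadd u u' hu hu' => rw [add_mul, map_add, hu, hu', map_add, add_mul]
      | hX a k =>
        induction v using QTorus.induction with
        | h0 => simp
        | hadd v v' hv hv' => rw [mul_add, map_add, hv, hv', map_add, mul_add]
        | hX b l =>
          rw [smul_mul_smul_comm, X_mul_X, map_smul, map_smul, map_smul, map_smul, lift_X, lift_X,
            lift_X, smul_mul_smul_comm, X_mul_X, hf, map_add])

theorem map_X (f : L →ₗ[ℤ] L') (hf : ∀ a b, ω' (f a) (f b) = ω a b) (k : L) :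
    map q f hf (X q ω k) = X q ω' (f k) := lift_X q _ k

theorem map_injective (f : L →ₗ[ℤ] L') (hf : ∀ a b, ω' (f a) (f b) = ω a b)
    (hinj : Function.Injective f) : Function.Injective (map q f hf) := by
  -- Monomials go to monomials without scalar factors, so on coefficients the map only relabels
  -- exponents.
  have h : ∀ u : QTorus q ω, map q f hf u = (Finsupp.mapDomain f (u : L →₀ ℂ) : L' →₀ ℂ) := by
    intro u
    refine (Finsupp.linearCombination_apply ℂ _).trans ?_
    refine Finsupp.sum_congr fun k _ => ?_
    exact Finsupp.smul_single_one (f k) _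
  intro u v huv
  rw [h, h] at huv
  exact Finsupp.mapDomain_injective hinj huv

end QTorus

/-! ### The quantum torus of the amalgamated lattice -/

namespace IdealTriangulation

variable {F : Type*} [Fintype F] [DecidableEq F] (T : IdealTriangulation F) (q : ℂˣ)

/-- The form on the amalgamated lattice. -/
def amalgamForm : LinearMap.BilinForm ℤ T.Amalgam :=
  T.kashaevForm.compl₁₂ T.iAmalgam T.iAmalgam

/-- The quantum torus of the amalgamated lattice. -/
abbrev TAmalgam : Type _ := QTorus q T.amalgamForm

theorem amalgamForm_mk (r r' : T.R) (h h' : T.H) :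
    T.amalgamForm (Submodule.Quotient.mk (r, h)) (Submodule.Quotient.mk (r', h')) =
      T.epsR r r' + 2 * T.inter h h' := T.kashaevForm_iAmalgam r r' h h'

/-- The inclusion of `R_λ`. -/
def inclR : T.R →ₗ[ℤ] T.Amalgam := T.amalgam.mkQ ∘ₗ LinearMap.inl ℤ T.R T.H

/-- The inclusion of `H`. -/
def inclH : T.H →ₗ[ℤ] T.Amalgam := T.amalgam.mkQ ∘ₗ LinearMap.inr ℤ T.R T.H

theorem inclR_add_inclH (r : T.R) (h : T.H) :
    T.inclR r + T.inclH h = Submodule.Quotient.mk (r, h) := by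
  change T.amalgam.mkQ (r, 0) + T.amalgam.mkQ (0, h) = T.amalgam.mkQ (r, h)
  rw [← map_add, Prod.mk_add_mk, add_zero, zero_add]

theorem inclR_cP (p : T.P) : T.inclR (T.cP p) = T.inclH (T.gammaP p) := by
  refine (Submodule.Quotient.eq _).2 ?_
  simpa using T.cP_neg_gammaP_mem p

theorem amalgamForm_inclR (r r' : T.R) : T.amalgamForm (T.inclR r) (T.inclR r') = T.epsR r r' :=
  (T.amalgamForm_mk r r' 0 0).trans (by simp)

theorem amalgamForm_inclH (h h' : T.H) :
    T.amalgamForm (T.inclH h) (T.inclH h') = ((2 : ℤ) • T.inter) h h' :=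
  (T.amalgamForm_mk 0 0 h h').trans (by simp)

theorem amalgamForm_inclR_inclH (r : T.R) (h : T.H) :
    T.amalgamForm (T.inclR r) (T.inclH h) = 0 :=
  (T.amalgamForm_mk r 0 0 h).trans (by simp)

theorem amalgamForm_inclH_inclR (r : T.R) (h : T.H) :
    T.amalgamForm (T.inclH h) (T.inclR r) = 0 :=
  (T.amalgamForm_mk 0 r h 0).trans (by simp)

theorem amalgamForm_cP_left (p : T.P) (u : T.Amalgam) :
    T.amalgamForm (T.inclR (T.cP p)) u = 0 := by
  obtain ⟨⟨r, h⟩, rfl⟩ := Submodule.mkQ_surjective _ u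
  exact (T.amalgamForm_mk _ r 0 h).trans (by simp [epsR_cP_left])

theorem amalgamForm_cP_right (p : T.P) (u : T.Amalgam) :
    T.amalgamForm u (T.inclR (T.cP p)) = 0 := by
  obtain ⟨⟨r, h⟩, rfl⟩ := Submodule.mkQ_surjective _ u
  -- Replacing `c` by `γ` moves the question to `H`, where vanishing in the right argument is
  -- `inter_gammaP_right`.
  rw [inclR_cP]
  exact (T.amalgamForm_mk r 0 h _).trans (by simp [inter_gammaP_right])

/-- The homomorphism `ℂ[P_λ] → 𝕋_q` of the amalgamated lattice with `v ↦ x^{c_v} = x^{γ_v}`. -/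
def toTAmalgam : T.CP →ₐ[ℂ] T.TAmalgam q :=
  AddMonoidAlgebra.lift ℂ (T.TAmalgam q) T.P
    { toFun := fun p => QTorus.X q _ (T.inclR (T.cP p.toAdd))
      map_one' := by rw [toAdd_one, map_zero, map_zero]; rfl
      map_mul' := fun a b => by
        rw [QTorus.X_mul_X_of_radical _ _ _ _ (T.amalgamForm_cP_left _ _), toAdd_mul, map_add,
          map_add] }

theorem toTAmalgam_central (a : T.CP) (f : T.TAmalgam q) : Commute (T.toTAmalgam q a) f := by
  induction a using AddMonoidAlgebra.induction_on with
  | of p =>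
    simpa [toTAmalgam] using QTorus.X_central q _ (T.inclR (T.cP p))
      (T.amalgamForm_cP_left p) (T.amalgamForm_cP_right p) f
  | add a b ha hb => rw [map_add]; exact ha.add_left hb
  | smul r a ha => rw [map_smul]; exact ha.smul_left r

instance : Algebra T.CP (T.TAmalgam q) :=
  (T.toTAmalgam q).toRingHom.toAlgebra' (fun a f => T.toTAmalgam_central q a f)

instance : IsScalarTower ℂ T.CP (T.TAmalgam q) :=
  IsScalarTower.of_algebraMap_eq fun r => ((T.toTAmalgam q).commutes r).symm

theorem algHom_CP_ext {A : Type*} [Ring A] [Algebra ℂ A] {f g : T.CP →ₐ[ℂ] A}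
    (h : ∀ p : T.P, f (AddMonoidAlgebra.of ℂ T.P (.ofAdd p)) =
      g (AddMonoidAlgebra.of ℂ T.P (.ofAdd p))) : f = g := by
  ext p
  exact h _

/-- The map `𝕋^CFr_q(λ) → 𝕋_q` into the torus of the amalgamated lattice. -/
def fromCFr : T.TCFr q →ₐ[ℂ] T.TAmalgam q :=
  RingQuot.liftAlgHom ℂ
    ⟨QTorus.map q (T.inclR ∘ₗ Submodule.mkQ _) (fun a b => T.amalgamForm_inclR _ _), by
      rintro _ _ ⟨rfl, rfl⟩
      refine (QTorus.map_X q _ _ _).trans (Eq.trans ?_ (map_one _).symm)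
      have h : (Submodule.Quotient.mk 1 : T.R) = 0 :=
        (Submodule.Quotient.mk_eq_zero _).2 (Submodule.mem_span_singleton_self _)
      change QTorus.X q _ (T.inclR (Submodule.Quotient.mk 1)) = 1
      rw [h, map_zero, QTorus.X_zero]⟩

theorem fromCFr_monoCFr (r : T.R) :
    T.fromCFr q (T.monoCFr q r) = QTorus.X q _ (T.inclR r) := by
  obtain ⟨k, rfl⟩ := Submodule.mkQ_surjective _ r
  refine (RingQuot.liftAlgHom_mkAlgHom_apply ..).trans ?_
  exact QTorus.map_X q _ _ k

/-- The map `𝕋_q(H) → 𝕋_q` into the torus of the amalgamated lattice. -/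
def fromTH : T.TH q →ₐ[ℂ] T.TAmalgam q := QTorus.map q T.inclH T.amalgamForm_inclH

theorem algebraMap_CFr_of (p : T.P) :
    algebraMap T.CP (T.TCFr q) (AddMonoidAlgebra.of ℂ T.P (.ofAdd p)) = T.monoCFr q (T.cP p) := by
  change T.toCFr q _ = _
  simp [toCFr]

theorem algebraMap_TH_of (p : T.P) :
    algebraMap T.CP (T.TH q) (AddMonoidAlgebra.of ℂ T.P (.ofAdd p)) =
      QTorus.X q _ (T.gammaP p) := by
  change T.toTH q _ = _
  simp [toTH]

theorem algebraMap_TAmalgam_of (p : T.P) :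
    algebraMap T.CP (T.TAmalgam q) (AddMonoidAlgebra.of ℂ T.P (.ofAdd p)) =
      QTorus.X q _ (T.inclR (T.cP p)) := by
  change T.toTAmalgam q _ = _
  simp [toTAmalgam]

/-- `fromCFr` as a homomorphism of `ℂ[P_λ]`-algebras. -/
def fromCFrCP : T.TCFr q →ₐ[T.CP] T.TAmalgam q :=
  { (T.fromCFr q : T.TCFr q →+* T.TAmalgam q) with
    commutes' := fun a => by
      refine DFunLike.congr_fun (f := (T.fromCFr q).comp (T.toCFr q)) (g := T.toTAmalgam q)
        (T.algHom_CP_ext fun p => ?_) a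
      exact (congrArg (T.fromCFr q) (T.algebraMap_CFr_of q p)).trans
        ((T.fromCFr_monoCFr q _).trans (T.algebraMap_TAmalgam_of q p).symm) }

/-- `fromTH` as a homomorphism of `ℂ[P_λ]`-algebras. -/
def fromTHCP : T.TH q →ₐ[T.CP] T.TAmalgam q :=
  { (T.fromTH q : T.TH q →+* T.TAmalgam q) with
    commutes' := fun a => by
      refine DFunLike.congr_fun (f := (T.fromTH q).comp (T.toTH q)) (g := T.toTAmalgam q)
        (T.algHom_CP_ext fun p => ?_) a
      refine (congrArg (T.fromTH q) (T.algebraMap_TH_of q p)).trans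
        (Eq.trans ?_ (T.algebraMap_TAmalgam_of q p).symm)
      rw [inclR_cP]
      exact QTorus.map_X q _ _ _ }

/-! ### Embedding the tensor product in the amalgamated torus -/

theorem TCFr_induction {p : T.TCFr q → Prop} (f : T.TCFr q) (h0 : p 0)
    (hadd : ∀ f g, p f → p g → p (f + g)) (hX : ∀ (a : ℂ) r, p (a • T.monoCFr q r)) : p f := by
  obtain ⟨f, rfl⟩ := T.projCFr_surjective q f
  induction f using QTorus.induction with
  | h0 => rwa [map_zero]
  | hadd f g hf hg => rw [map_add]; exact hadd _ _ hf hg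
  | hX a k => rw [map_smul, ← monoCFr_mk]; exact hX _ _

/-- On monomials this is the orthogonality of `R_λ` and `H`; it is what allows the two homomorphisms
to be combined on the tensor product. -/
theorem fromCFr_commute_fromTH (f : T.TCFr q) (g : T.TH q) :
    Commute (T.fromCFr q f) (T.fromTH q g) := by
  induction f using T.TCFr_induction q with
  | h0 => rw [map_zero]; exact Commute.zero_left _
  | hadd f f' hf hf' => rw [map_add]; exact hf.add_left hf'
  | hX a r =>
    rw [map_smul]
    refine Commute.smul_left ?_ a
    induction g using QTorus.induction with
    | h0 => rw [map_zero]; exact Commute.zero_right _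
    | hadd g g' hg hg' => rw [map_add]; exact hg.add_right hg'
    | hX b h =>
      rw [map_smul]
      refine Commute.smul_right ?_ b
      rw [fromCFr_monoCFr, fromTH, QTorus.map_X, Commute, SemiconjBy,
        QTorus.X_mul_X_of_radical _ _ _ _ (T.amalgamForm_inclR_inclH r h),
        QTorus.X_mul_X_of_radical _ _ _ _ (T.amalgamForm_inclH_inclR r h), add_comm]

/-- The homomorphism from the tensor product to the torus of the amalgamated lattice. -/
def tensorToAmalgam : T.TCFr q ⊗[T.CP] T.TH q →ₐ[T.CP] T.TAmalgam q :=
  Algebra.TensorProduct.lift (T.fromCFrCP q) (T.fromTHCP q)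
    (fun f g => T.fromCFr_commute_fromTH q f g)

theorem tensorToAmalgam_tmul (r : T.R) (h : T.H) :
    T.tensorToAmalgam q (T.monoCFr q r ⊗ₜ[T.CP] QTorus.X q ((2 : ℤ) • T.inter) h) =
      QTorus.X q T.amalgamForm (Submodule.Quotient.mk (r, h)) := by
  refine (Algebra.TensorProduct.lift_tmul ..).trans ?_
  change T.fromCFr q _ * T.fromTH q _ = _
  rw [fromCFr_monoCFr, fromTH, QTorus.map_X,
    QTorus.X_mul_X_of_radical _ _ _ _ (T.amalgamForm_inclR_inclH r h), inclR_add_inclH]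

/-- A difference in `amalgam` comes from a single `p ∈ P_λ`. The central monomial of `p` splits off
the left factor as a scalar from `ℂ[P_λ]` and is absorbed by the right factor. This makes the map
back to the tensor product well defined. -/
theorem tmul_eq_of_mem_amalgam {u v : T.R × T.H} (huv : u - v ∈ T.amalgam) :
    T.monoCFr q u.1 ⊗ₜ[T.CP] QTorus.X q ((2 : ℤ) • T.inter) u.2 =
      T.monoCFr q v.1 ⊗ₜ[T.CP] QTorus.X q ((2 : ℤ) • T.inter) v.2 := by
  let N : Submodule ℤ (T.R × T.H) := LinearMap.range (T.cP.prod (- T.gammaP))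
  have hN : T.amalgam ≤ N := T.amalgam_le fun p => ⟨p, rfl⟩
  obtain ⟨p, hp⟩ := hN huv
  have h1 : u.1 = T.cP p + v.1 := by
    rw [← sub_eq_iff_eq_add]; exact (congrArg Prod.fst hp).symm
  have h2 : v.2 = T.gammaP p + u.2 := by
    have : - T.gammaP p = u.2 - v.2 := congrArg Prod.snd hp
    rw [neg_eq_iff_eq_neg.1 this]
    abel
  rw [h1, h2, ← monoCFr_cP_mul, ← QTorus.X_mul_X_of_radical q _ (T.gammaP p) u.2
    (by simp [inter_gammaP_left]), ← algebraMap_CFr_of, ← algebraMap_TH_of, ← Algebra.smul_def,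
    ← Algebra.smul_def, TensorProduct.smul_tmul]

/-- The inverse of `tensorToAmalgam`. -/
def amalgamToTensor : T.TAmalgam q →ₗ[ℂ] T.TCFr q ⊗[T.CP] T.TH q :=
  QTorus.lift q _ fun k : T.Amalgam =>
    Quotient.lift (fun u : T.R × T.H =>
      T.monoCFr q u.1 ⊗ₜ[T.CP] QTorus.X q ((2 : ℤ) • T.inter) u.2)
      (fun _ _ huv => T.tmul_eq_of_mem_amalgam q ((Submodule.quotientRel_def _).1 huv)) k

theorem amalgamToTensor_X (r : T.R) (h : T.H) :
    T.amalgamToTensor q (QTorus.X q _ (Submodule.Quotient.mk (r, h))) =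
      T.monoCFr q r ⊗ₜ[T.CP] QTorus.X q ((2 : ℤ) • T.inter) h :=
  QTorus.lift_X q _ _

theorem tensor_induction {p : T.TCFr q ⊗[T.CP] T.TH q → Prop} (f : T.TCFr q ⊗[T.CP] T.TH q)
    (h0 : p 0) (hadd : ∀ f g, p f → p g → p (f + g))
    (hX : ∀ (a : ℂ) r h, p (a • T.monoCFr q r ⊗ₜ[T.CP] QTorus.X q ((2 : ℤ) • T.inter) h)) :
    p f := by
  induction f using TensorProduct.induction_on with
  | zero => exact h0
  | add f g hf hg => exact hadd _ _ hf hg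
  | tmul f g =>
    induction f using T.TCFr_induction q with
    | h0 => rwa [TensorProduct.zero_tmul]
    | hadd f f' hf hf' => rw [TensorProduct.add_tmul]; exact hadd _ _ hf hf'
    | hX a r =>
      induction g using QTorus.induction with
      | h0 => rwa [TensorProduct.tmul_zero]
      | hadd g g' hg hg' => rw [TensorProduct.tmul_add]; exact hadd _ _ hg hg'
      | hX b h =>
        rw [TensorProduct.tmul_smul, ← TensorProduct.smul_tmul', smul_smul]
        exact hX _ _ _

/-- A left inverse needs checking only on the tensors of monomials, which span. No linear
independence of the monomials in the quotient `TCFr` has to be known. -/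
theorem tensorToAmalgam_injective : Function.Injective (T.tensorToAmalgam q) := by
  refine Function.LeftInverse.injective (g := T.amalgamToTensor q) fun f => ?_
  induction f using T.tensor_induction q with
  | h0 => rw [map_zero, map_zero]
  | hadd f g hf hg => rw [map_add, map_add, hf, hg]
  | hX a r h =>
    -- The scalar `a` is complex, while `tensorToAmalgam` is given as a homomorphism over `ℂ[P_λ]`.
    rw [← AlgHom.restrictScalars_apply ℂ, map_smul, map_smul, AlgHom.restrictScalars_apply,
      tensorToAmalgam_tmul, amalgamToTensor_X]

/-- The homomorphism `i_q`. -/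
def toKashaev : T.TCFr q ⊗[T.CP] T.TH q →ₐ[ℂ] T.TK q :=
  -- Compatibility with the forms is definitional, since `amalgamForm` is the pullback along
  -- `iAmalgam`.
  (QTorus.map q T.iAmalgam (fun _ _ => rfl) : T.TAmalgam q →ₐ[ℂ] T.TK q).comp
    ((T.tensorToAmalgam q).restrictScalars ℂ)

theorem toKashaev_tmul (r : T.R) (h : T.H) :
    T.toKashaev q (T.monoCFr q r ⊗ₜ[T.CP] QTorus.X q ((2 : ℤ) • T.inter) h) =
      QTorus.X q T.kashaevForm (T.iAmalgam (Submodule.Quotient.mk (r, h))) :=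
  (congrArg (QTorus.map q T.iAmalgam fun _ _ => rfl) (T.tensorToAmalgam_tmul q r h)).trans
    (QTorus.map_X (ω := T.amalgamForm) q T.iAmalgam (fun _ _ => rfl) _)

theorem toKashaev_injective : Function.Injective (T.toKashaev q) :=
  (QTorus.map_injective (ω := T.amalgamForm) q T.iAmalgam (fun _ _ => rfl)
    T.iAmalgam_injective).comp (T.tensorToAmalgam_injective q)

end IdealTriangulation

end

theorem mainTheorem5 {F : Type*} [Fintype F] [DecidableEq F] (T : IdealTriangulation F) :
    Function.Injective T.iCFr ∧ Function.Injective T.iH ∧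
    ∃ i : ((T.R × T.H) ⧸ T.amalgam) →ₗ[ℤ] T.L,
      (∀ (r : T.R) (h : T.H),
        i (Submodule.Quotient.mk (r, h)) = T.iCFr r + T.iH h) ∧
      Function.Injective i ∧
      (∀ (r r' : T.R) (h h' : T.H),
        T.kashaevForm (i (Submodule.Quotient.mk (r, h))) (i (Submodule.Quotient.mk (r', h'))) =
          T.epsR r r' + 2 * T.inter h h') ∧
      ∀ q : ℂˣ, ∃ iq : (T.TCFr q ⊗[T.CP] T.TH q) →ₐ[ℂ] T.TK q,
        (∀ (r : T.R) (h : T.H),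
          iq (T.monoCFr q r ⊗ₜ[T.CP] QTorus.X q ((2 : ℤ) • T.inter) h) =
            QTorus.X q T.kashaevForm (i (Submodule.Quotient.mk (r, h)))) ∧
        Function.Injective iq := by
  refine ⟨T.iCFr_injective, T.iH_injective, T.iAmalgam, T.iAmalgam_mk, T.iAmalgam_injective,
    T.kashaevForm_iAmalgam, fun q =>
    ⟨T.toKashaev q, T.toKashaev_tmul q, T.toKashaev_injective q⟩⟩
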